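/- Let $\kappa,k,p,n$ be non-negative integers and $m$ an integer with $\kappa\ge 2k+2$, $k+1\le n\le\kappa$ and $-p+2k+1\le m\le\kappa-p-1$. Put $q=e^{\pi i/\kappa}$ and $q^{x}=e^{\pi i x/\kappa}$ for $x\in\mathbb C$. Then $$\Psi^{(k)}(q^{-1},-m-p+k,n-1)-\Psi^{(k)}(q^{-1},-m-p+k,-n-1)=P^{(k+1)}_{n-k-1}(m+p-k)\prod_{j=1}^{k}\left(q^{-n+2j}-q^{n}\right),$$ where the two sides are defined as follows. *Trace functions.* Let $q$ be $e^{\pi i/\kappa}$ or $e^{-\pi i/\kappa}$, and let $q^x$ be $e^{\pi i x/\kappa}$, respectively $e^{-\pi i x/\kappa}$. The quantum group $U_q(sl_2)$ has generators $E,F,q^{ch}$ ($c\in\mathbb C$) and relations $q^{0h}=1$, $q^{ch}q^{c'h}=q^{(c+c')h}$, $q^{ch}Eq^{-ch}=q^{2c}E$, $q^{ch}Fq^{-ch}=q^{-2c}F$, $EF-FE=\frac{q^h-q^{-h}}{q-q^{-1}}$, and comultiplication $\Delta(E)=E\otimes q^h+1\otimes E$, $\Delta(F)=F\otimes1+q^{-h}\otimes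 F$, $\Delta(q^{ch})=q^{ch}\otimes q^{ch}$. Let $M_\mu$ be the Verma module with highest weight $\mu$ and highest weight vector $v_\mu$, let $U$ be the irreducible module of highest weight $2k$ (of dimension $2k+1$), and let $U[0]$ be its one-dimensional zero weight space. For generic $\mu$ (that is, $q^{2(\mu-l)}\ne1$ for all integers $l\ge 0$) and $u\in U[0]$ let $\Phi^u_\mu:M_\mu\to M_\mu\otimes U$ be the intertwining operator with $\Phi_\mu^uv_\mu=v_\mu\otimes u+\sum_{j\ge1}F^jv_\mu\otimes u_j$, $u_j\in U$. For $|q^{-2\nu}|<1$ the series $\operatorname{Tr}|_{M_\mu}(\Phi_\mu^uq^{\nu h})\in U[0]$ converges; let $\psi^{(k)}(q,\nu,\mu)$ be the scalar by which it multiplies $u$. Then $\Psi^{(k)}(q,\nu,\mu)$ is the function defined by $$\Psi^{(k)}(q,\nu,\mu)=\prod_{j=1}^{k}\frac{q^{\mu+1-j}-q^{-\mu-1+j}}{q^{\nu+j}-q^{-\nu-j}}\;\psi^{(k)}(q,\nu,\mu)$$ for such $\mu,\nu$, and by analytic continuation otherwise: it is holomorphic in $\nu$ on the set where $q^{2(\nu-l)}\neq1$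 for all integers $l$ with $|l|\le k$ (for every $\mu$), and entire in $\mu$ (for every $\nu$ in this set). *Macdonald polynomials.* For an indeterminate $q$ and an integer $k\ge0$ the Macdonald polynomials $P^{(k)}_n(x)$, $n\ge 0$, of type $A_1$ are the Laurent polynomials in $q^x$ with coefficients in $\mathbb C(q)$, invariant under $x\mapsto-x$, such that $P_0^{(k)}=1$, $P_n^{(k)}(x)=q^{nx}+q^{-nx}+{}$lower order terms for $n>0$, and $\langle P^{(k)}_m,P^{(k)}_n\rangle=0$ for $m\ne n$, where $\langle f,g\rangle$ is one half of the constant term of $fg\prod_{j=0}^{k-1}(1-q^{2(j+x)})(1-q^{2(j-x)})$. The coefficients of $P^{(k+1)}_{n-k-1}$ have no pole at $q=e^{\pi i/\kappa}$ (this is part of the claim), and $P^{(k+1)}_{n-k-1}(m+p-k)$ above is the value at this $q$ and at $x=m+p-k$. -/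

import Mathlib

open scoped TensorProduct LaurentPolynomial

noncomputable section

namespace QuantumTrace

/-! Powers of `q` and `q`-numbers. The base is `q = exp η`, with the branch `q ^ x = exp (η x)`;
replacing `q` by `q⁻¹` means replacing `η` by `-η`. -/

/-- `q ^ x` for `q = exp η` and a complex exponent `x`. -/
def qpow (η x : ℂ) : ℂ := Complex.exp (η * x)

/-- The `q`-number `[x] = (q ^ x - q ^ (-x)) / (q - q ^ (-1))`. -/
def qnum (η x : ℂ) : ℂ := (qpow η x - qpow η (-x)) / (qpow η 1 - qpow η (-1))

theorem qpow_zero (η : ℂ) : qpow η 0 = 1 := by simp [qpow]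

theorem qpow_add (η x y : ℂ) : qpow η (x + y) = qpow η x * qpow η y := by
  simp [qpow, mul_add, Complex.exp_add]

theorem qnum_zero (η : ℂ) : qnum η 0 = 0 := by simp [qnum]

theorem qnum_commutator (η a b : ℂ) :
    qnum η (a + 1) * qnum η (b - a) - qnum η a * qnum η (b - a + 1) =
      (qpow η (b - 2 * a) - qpow η (-(b - 2 * a))) / (qpow η 1 - qpow η (-1)) := by
  by_cases h : qpow η 1 - qpow η (-1) = 0
  · simp [qnum, h]
  · have key : (qpow η (a + 1) - qpow η (-(a + 1))) * (qpow η (b - a) - qpow η (-(b - a))) -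
        (qpow η a - qpow η (-a)) * (qpow η (b - a + 1) - qpow η (-(b - a + 1))) =
        (qpow η (b - 2 * a) - qpow η (-(b - 2 * a))) * (qpow η 1 - qpow η (-1)) := by
      simp only [sub_mul, mul_sub, ← qpow_add]
      ring_nf
    rw [qnum, qnum, qnum, qnum, div_mul_div_comm, div_mul_div_comm, ← sub_div, key,
      mul_div_mul_right _ _ h]

/-! The quantum group `U_q(sl₂)`: a module over it is a vector space with operators
`E`, `F`, `q ^ (c h)` (`c ∈ ℂ`) subject to the defining relations. -/

/-- A structure of `U_q(sl₂)`-module on `V`; `K c` is the action of `q ^ (c h)`. -/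
structure UqModule (η : ℂ) (V : Type*) [AddCommGroup V] [Module ℂ V] where
  E : Module.End ℂ V
  F : Module.End ℂ V
  K : ℂ → Module.End ℂ V
  K_zero : K 0 = 1
  K_add : ∀ c d, K (c + d) = K c * K d
  K_E : ∀ c, K c * E * K (-c) = qpow η (2 * c) • E
  K_F : ∀ c, K c * F * K (-c) = qpow η (-(2 * c)) • F
  E_F : E * F - F * E = (qpow η 1 - qpow η (-1))⁻¹ • (K 1 - K (-1))

/-- Linear maps commuting with the actions of the generators. -/
def IsUqHom {η : ℂ} {V W : Type*} [AddCommGroup V] [Module ℂ V] [AddCommGroup W] [Module ℂ W]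
    (A : UqModule η V) (B : UqModule η W) (φ : V →ₗ[ℂ] W) : Prop :=
  φ ∘ₗ A.E = B.E ∘ₗ φ ∧ φ ∘ₗ A.F = B.F ∘ₗ φ ∧ ∀ c, φ ∘ₗ A.K c = B.K c ∘ₗ φ

section Tensor

variable {η : ℂ} {V W : Type*} [AddCommGroup V] [Module ℂ V] [AddCommGroup W] [Module ℂ W]

theorem UqModule.K_mul_neg (A : UqModule η V) (c : ℂ) : A.K c * A.K (-c) = 1 := by
  rw [← A.K_add, add_neg_cancel, A.K_zero]

theorem UqModule.K_neg_mul (A : UqModule η V) (c : ℂ) : A.K (-c) * A.K c = 1 := by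
  rw [← A.K_add, neg_add_cancel, A.K_zero]

theorem UqModule.K_comm (A : UqModule η V) (c d : ℂ) : A.K c * A.K d = A.K d * A.K c := by
  rw [← A.K_add, add_comm, A.K_add]

theorem UqModule.K_mul_E (A : UqModule η V) (c : ℂ) :
    A.K c * A.E = qpow η (2 * c) • (A.E * A.K c) := by
  rw [← smul_mul_assoc, ← A.K_E, mul_assoc, A.K_neg_mul, mul_one]

theorem UqModule.K_mul_F (A : UqModule η V) (c : ℂ) :
    A.K c * A.F = qpow η (-(2 * c)) • (A.F * A.K c) := by
  rw [← smul_mul_assoc, ← A.K_F, mul_assoc, A.K_neg_mul, mul_one]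

/-- The tensor product of two modules, for the comultiplication
`Δ E = E ⊗ q ^ h + 1 ⊗ E`, `Δ F = F ⊗ 1 + q ^ (-h) ⊗ F`, `Δ q ^ (c h) = q ^ (c h) ⊗ q ^ (c h)`. -/
def UqModule.tensor (A : UqModule η V) (B : UqModule η W) : UqModule η (V ⊗[ℂ] W) where
  E := TensorProduct.map A.E (B.K 1) + TensorProduct.map 1 B.E
  F := TensorProduct.map A.F 1 + TensorProduct.map (A.K (-1)) B.F
  K c := TensorProduct.map (A.K c) (B.K c)
  K_zero := by rw [A.K_zero, B.K_zero, TensorProduct.map_one]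
  K_add c d := by rw [A.K_add, B.K_add, TensorProduct.map_mul]
  K_E c := by
    simp only [mul_add, add_mul, ← TensorProduct.map_mul, A.K_E, B.K_E, mul_one, A.K_mul_neg]
    rw [B.K_comm c 1, mul_assoc, B.K_mul_neg, mul_one, TensorProduct.map_smul_left,
      TensorProduct.map_smul_right, smul_add]
  K_F c := by
    simp only [mul_add, add_mul, ← TensorProduct.map_mul, A.K_F, B.K_F, mul_one, B.K_mul_neg]
    rw [A.K_comm c (-1), mul_assoc, A.K_mul_neg, mul_one, TensorProduct.map_smul_left,
      TensorProduct.map_smul_right, smul_add]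
  E_F := by
    have hA : A.E * A.F = A.F * A.E + (qpow η 1 - qpow η (-1))⁻¹ • (A.K 1 - A.K (-1)) := by
      rw [← A.E_F]; abel
    have hB : B.E * B.F = B.F * B.E + (qpow η 1 - qpow η (-1))⁻¹ • (B.K 1 - B.K (-1)) := by
      rw [← B.E_F]; abel
    have h2 : TensorProduct.map (A.K (-1) * A.E) (B.F * B.K 1) =
        TensorProduct.map (A.E * A.K (-1)) (B.K 1 * B.F) := by
      rw [A.K_mul_E, B.K_mul_F, TensorProduct.map_smul_left, TensorProduct.map_smul_right]
      congr 2; norm_num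
    simp only [mul_add, add_mul, ← TensorProduct.map_mul, one_mul, mul_one, h2, hA, hB]
    simp only [TensorProduct.map_add_left, TensorProduct.map_add_right,
      TensorProduct.map_smul_left, TensorProduct.map_smul_right, sub_eq_add_neg, smul_add]
    simp only [← neg_one_smul ℂ (A.K (-1)), ← neg_one_smul ℂ (B.K (-1)),
      TensorProduct.map_smul_left, TensorProduct.map_smul_right]
    module

end Tensor

/-! The Verma module `M_μ`, with basis `F ^ i v_μ`, `i ≥ 0`. -/

/-- The Verma module of highest weight `μ` on the basis `e i = F ^ i v_μ`:
`F (e i) = e (i + 1)`, `E (e i) = [i] [μ - i + 1] e (i - 1)`,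
`q ^ (c h) (e i) = q ^ (c (μ - 2 i)) e i`. -/
def verma (η μ : ℂ) : UqModule η (ℕ →₀ ℂ) where
  E := Finsupp.lsum ℂ fun i : ℕ => (qnum η i * qnum η (μ - i + 1)) • Finsupp.lsingle (i - 1)
  F := Finsupp.lsum ℂ fun i : ℕ => Finsupp.lsingle (i + 1)
  K c := Finsupp.lsum ℂ fun i : ℕ => qpow η (c * (μ - 2 * i)) • Finsupp.lsingle i
  K_zero := by
    ext i : 2
    simp [qpow_zero]
  K_add c d := by
    ext i : 2
    simp [add_mul, qpow_add, mul_comm]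
  K_E c := by
    ext i : 2
    rcases i with _ | i
    · simp [qnum_zero]
    · simp only [LinearMap.comp_apply, Module.End.mul_apply, Finsupp.lsum_single,
        LinearMap.smul_apply, Finsupp.lsingle_apply, Nat.add_sub_cancel,
        Finsupp.smul_single, smul_eq_mul, mul_one]
      congr 1
      have h : qpow η (-c * (μ - 2 * ((i + 1 : ℕ) : ℂ))) * qpow η (c * (μ - 2 * (i : ℂ))) =
          qpow η (2 * c) := by
        rw [← qpow_add]; congr 1; push_cast; ring
      rw [← h]; ring
  K_F c := by
    ext i : 2
    simp only [LinearMap.comp_apply, Module.End.mul_apply, Finsupp.lsum_single,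
      LinearMap.smul_apply, Finsupp.lsingle_apply,
      Finsupp.smul_single, smul_eq_mul, mul_one]
    congr 1
    rw [← qpow_add]; congr 1; push_cast; ring
  E_F := by
    ext i : 2
    have h := qnum_commutator η i (μ : ℂ)
    rcases i with _ | i
    · simp only [LinearMap.comp_apply, Module.End.mul_apply, LinearMap.sub_apply,
        Finsupp.lsum_single, LinearMap.smul_apply, Finsupp.lsingle_apply,
        Finsupp.smul_single, smul_eq_mul, mul_one, Nat.add_sub_cancel,
        ← Finsupp.single_sub, one_mul, neg_one_mul]
      rw [← div_eq_inv_mul, ← h, Nat.cast_zero, qnum_zero, zero_mul, sub_zero,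
        Finsupp.single_zero, sub_zero]
      congr 1
      push_cast
      ring_nf
    · simp only [LinearMap.comp_apply, Module.End.mul_apply, LinearMap.sub_apply,
        Finsupp.lsum_single, LinearMap.smul_apply, Finsupp.lsingle_apply,
        Finsupp.smul_single, smul_eq_mul, mul_one, Nat.add_sub_cancel,
        ← Finsupp.single_sub, one_mul, neg_one_mul]
      congr 1
      rw [← div_eq_inv_mul, ← h]
      push_cast
      ring_nf

/-! The irreducible module `U` of highest weight `d`. -/

/-- The module of highest weight `d` and dimension `d + 1`, on the basis `w 0, …, w d`:
`F (w i) = w (i + 1)` and `F (w d) = 0`, `E (w i) = [i] [d - i + 1] w (i - 1)`,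
`q ^ (c h) (w i) = q ^ (c (d - 2 i)) w i`. Vectors are given by their coordinates. -/
def irrep (η : ℂ) (d : ℕ) : UqModule η (Fin (d + 1) → ℂ) where
  E := LinearMap.pi fun i => if h : i.val + 1 < d + 1 then
    (qnum η (i.val + 1) * qnum η (d - i.val)) • LinearMap.proj ⟨i.val + 1, h⟩ else 0
  F := LinearMap.pi fun i => if 0 < i.val then
    LinearMap.proj ⟨i.val - 1, lt_of_le_of_lt (Nat.sub_le _ _) i.isLt⟩ else 0
  K c := LinearMap.pi fun i => qpow η (c * (d - 2 * (i.val : ℂ))) • LinearMap.proj i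
  K_zero := by
    refine LinearMap.ext fun f => funext fun i => ?_
    simp [qpow_zero]
  K_add c e := by
    refine LinearMap.ext fun f => funext fun i => ?_
    simp [add_mul, qpow_add, mul_assoc]
  K_E c := by
    refine LinearMap.ext fun f => funext fun i => ?_
    by_cases h : i.val + 1 < d + 1
    · simp only [Module.End.mul_apply, LinearMap.pi_apply, LinearMap.smul_apply,
        LinearMap.proj_apply, Pi.smul_apply, dif_pos h, smul_eq_mul]
      have h : qpow η (c * (d - 2 * (i.val : ℂ))) *
          qpow η (-c * (d - 2 * ((i.val + 1 : ℕ) : ℂ))) = qpow η (2 * c) := by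
        rw [← qpow_add]; congr 1; push_cast; ring
      rw [← h]; ring
    · simp only [Module.End.mul_apply, LinearMap.pi_apply, LinearMap.smul_apply,
        LinearMap.proj_apply, Pi.smul_apply, dif_neg h, LinearMap.zero_apply, smul_zero]
  K_F c := by
    refine LinearMap.ext fun f => funext fun i => ?_
    by_cases h : 0 < i.val
    · simp only [Module.End.mul_apply, LinearMap.pi_apply, LinearMap.smul_apply,
        LinearMap.proj_apply, Pi.smul_apply, if_pos h, smul_eq_mul]
      have h : qpow η (c * (d - 2 * (i.val : ℂ))) *
          qpow η (-c * (d - 2 * ((i.val - 1 : ℕ) : ℂ))) = qpow η (-(2 * c)) := by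
        rw [← qpow_add]; congr 1; rw [Nat.cast_sub h]; push_cast; ring
      rw [← h]; ring
    · simp only [Module.End.mul_apply, LinearMap.pi_apply, LinearMap.smul_apply,
        LinearMap.proj_apply, Pi.smul_apply, if_neg h, LinearMap.zero_apply, smul_zero]
  E_F := by
    refine LinearMap.ext fun f => funext fun i => ?_
    obtain ⟨i, hi⟩ := i
    have hc := qnum_commutator η i (d : ℂ)
    have e1 : ∀ x, (qpow η 1 - qpow η (-1))⁻¹ * (qpow η (d - 2 * (i : ℂ)) * x -
        qpow η (-(d - 2 * (i : ℂ))) * x) =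
        (qnum η (i + 1) * qnum η (d - i) - qnum η i * qnum η (d - i + 1)) * x := by
      intro x; rw [hc]; ring
    simp only [Module.End.mul_apply, LinearMap.sub_apply, LinearMap.pi_apply,
      LinearMap.smul_apply, LinearMap.proj_apply, Pi.sub_apply, Pi.smul_apply, smul_eq_mul,
      one_mul, neg_one_mul, e1]
    rcases i with _ | i
    · rw [if_neg (lt_irrefl 0)]
      by_cases h : 0 + 1 < d + 1
      · simp only [dif_pos h, LinearMap.smul_apply, LinearMap.proj_apply, LinearMap.pi_apply,
          if_pos (Nat.succ_pos 0), smul_eq_mul, LinearMap.zero_apply, sub_zero, Nat.cast_zero,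
          qnum_zero, zero_mul, Nat.add_sub_cancel]
      · have hd : d = 0 := by omega
        subst hd
        simp only [dif_neg h, LinearMap.zero_apply, Nat.cast_zero, sub_zero, qnum_zero,
          zero_mul, mul_zero]
    · simp only [if_pos (Nat.succ_pos i), LinearMap.proj_apply, LinearMap.pi_apply,
        Nat.add_sub_cancel, dif_pos hi, LinearMap.smul_apply, smul_eq_mul]
      have h2 : (d : ℂ) - i = d - ((i + 1 : ℕ) : ℂ) + 1 := by push_cast; ring
      by_cases h : i + 1 + 1 < d + 1
      · simp only [dif_pos h, LinearMap.smul_apply, LinearMap.proj_apply, LinearMap.pi_apply,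
          if_pos (Nat.succ_pos (i + 1)), smul_eq_mul, Nat.add_sub_cancel, h2]
        push_cast
        ring
      · have hd : d = i + 1 := by omega
        subst hd
        simp only [dif_neg h, LinearMap.zero_apply, h2, sub_self, qnum_zero, mul_zero]
        push_cast
        ring

/-! Intertwining operators and their traces. Here `U = irrep η (2 k)`. -/

/-- The linear map `M_μ ⊗ U → U` that extracts the coefficient of `F ^ i v_μ`. -/
def coordinate (U : Type*) [AddCommGroup U] [Module ℂ U] (i : ℕ) :
    (ℕ →₀ ℂ) ⊗[ℂ] U →ₗ[ℂ] U :=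
  (TensorProduct.lid ℂ U).toLinearMap ∘ₗ LinearMap.rTensor U (Finsupp.lapply i)

/-- `Φ : M_μ → M_μ ⊗ U` is the intertwining operator `Φ_μ ^ u`: it is `U_q(sl₂)`-linear, and
`Φ v_μ = v_μ ⊗ u + ∑_{j ≥ 1} F ^ j v_μ ⊗ u_j` for some `u_j`. -/
def IsIntertwiner (η μ : ℂ) (k : ℕ) (u : Fin (2 * k + 1) → ℂ)
    (Φ : (ℕ →₀ ℂ) →ₗ[ℂ] (ℕ →₀ ℂ) ⊗[ℂ] (Fin (2 * k + 1) → ℂ)) : Prop :=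
  IsUqHom (verma η μ) ((verma η μ).tensor (irrep η (2 * k))) Φ ∧
    coordinate _ 0 (Φ (Finsupp.single 0 1)) = u

/-- `ψ ∈ ℂ` is the value at `(ν, μ)` of the trace function given by a convergent series: for `u`
in the zero weight space `U[0]`, the operator `Φ_μ ^ u` exists and `Tr|_{M_μ} (Φ_μ ^ u q ^ (ν h))`,
the sum over the basis of `M_μ` of the (`U`-valued) diagonal entries, converges to `ψ u`. -/
def HasTrace (η ν μ : ℂ) (k : ℕ) (ψ : ℂ) : Prop :=
  ∀ u : Fin (2 * k + 1) → ℂ, (irrep η (2 * k)).K 1 u = u →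
    ∃ Φ, IsIntertwiner η μ k u Φ ∧
      HasSum (fun i : ℕ => coordinate _ i (Φ ((verma η μ).K ν (Finsupp.single i 1)))) (ψ • u)

/-- The values of `ν` at which no pole of the renormalized trace function can occur:
`[ν - l] ≠ 0` for all integers `l` with `|l| ≤ k`. -/
def regularDomain (η : ℂ) (k : ℕ) : Set ℂ :=
  {ν | ∀ l : ℤ, |l| ≤ (k : ℤ) → qpow η (2 * (ν - l)) ≠ 1}

/-- The conditions that determine the renormalized trace function `Ψ (ν, μ)` (for `ν` in
`regularDomain η k` and all `μ`): for generic `μ` and for `ν` in the region where the trace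
converges, it is
`∏_{j=1}^k (q ^ (μ + 1 - j) - q ^ (-μ - 1 + j)) / (q ^ (ν + j) - q ^ (-ν - j))`
times the trace function; in `ν` it is continued analytically to the regular domain; in `μ` it is
entire. The number `q = exp η` is supposed to be of absolute value `1`. -/
structure IsRenormalizedTrace (η : ℂ) (k : ℕ) (Ψ : ℂ → ℂ → ℂ) : Prop where
  eq_trace : ∀ μ ν : ℂ, (∀ l : ℕ, qpow η (2 * (μ - l)) ≠ 1) → ‖qpow η (-(2 * ν))‖ < 1 →
    ∃ ψ, HasTrace η ν μ k ψ ∧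
      Ψ ν μ = (∏ j ∈ Finset.Icc 1 k, (qpow η (μ + 1 - j) - qpow η (-μ - 1 + j)) /
        (qpow η (ν + j) - qpow η (-ν - j))) * ψ
  holomorphic_left : ∀ μ, DifferentiableOn ℂ (fun ν => Ψ ν μ) (regularDomain η k)
  holomorphic_right : ∀ ν ∈ regularDomain η k, Differentiable ℂ (fun μ => Ψ ν μ)

/-- The renormalized trace function `Ψ^{(k)} (q, ν, μ)` for `q = exp η`. -/
def renormalizedTrace (η : ℂ) (k : ℕ) : ℂ → ℂ → ℂ :=
  Classical.epsilon fun Ψ => IsRenormalizedTrace η k Ψ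

/-! Macdonald polynomials of type `A₁`. The Laurent variable `T` stands for `q ^ x`. -/

/-- `∏_{j=0}^{k-1} (1 - q ^ (2 (j + x))) (1 - q ^ (2 (j - x)))`. -/
def macdonaldWeight {R : Type*} [Field R] (q : R) (k : ℕ) : R[T;T⁻¹] :=
  ∏ j ∈ Finset.range k,
    ((1 - LaurentPolynomial.C (q ^ (2 * j)) * LaurentPolynomial.T 2) *
      (1 - LaurentPolynomial.C (q ^ (2 * j)) * LaurentPolynomial.T (-2)))

/-- `⟨f, g⟩`, half of the constant term of `f g` times the weight. -/
def macdonaldForm {R : Type*} [Field R] (q : R) (k : ℕ) (f g : R[T;T⁻¹]) : R :=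
  (1 / 2) * (f * g * macdonaldWeight q k).coeff 0

/-- The conditions that define the Macdonald polynomials `P_n^{(k)}`, `n ≥ 0`. -/
structure IsMacdonaldFamily {R : Type*} [Field R] (q : R) (k : ℕ) (P : ℕ → R[T;T⁻¹]) :
    Prop where
  even : ∀ n, LaurentPolynomial.invert (P n) = P n
  zero : P 0 = 1
  leading : ∀ n : ℕ, 0 < n → ∀ i : ℤ, (n : ℤ) ≤ |i| →
    (P n).coeff i =
      (LaurentPolynomial.T (n : ℤ) + LaurentPolynomial.T (-(n : ℤ)) : R[T;T⁻¹]).coeff i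
  orthogonal : ∀ m n, m ≠ n → macdonaldForm q k (P m) (P n) = 0

/-- The Macdonald polynomials for an indeterminate `q`, with coefficients in `ℂ(q)`. -/
def macdonald (k : ℕ) : ℕ → (RatFunc ℂ)[T;T⁻¹] :=
  Classical.epsilon fun P => IsMacdonaldFamily (RatFunc.X : RatFunc ℂ) k P

/-- The coefficients of `P_n^{(k)}`, as rational functions of `q`, have no pole at `q = exp η`. -/
def MacdonaldRegular (η : ℂ) (k n : ℕ) : Prop :=
  ∀ i : ℤ, ((macdonald k n).coeff i).denom.eval (qpow η 1) ≠ 0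

/-- The value `P_n^{(k)} (x)` at `q = exp η`: the coefficients are evaluated at this `q`, and
`T` is replaced by `q ^ x`. -/
def macdonaldValue (η : ℂ) (k n : ℕ) (x : ℂ) : ℂ :=
  ∑ i ∈ (macdonald k n).coeff.support,
    ((macdonald k n).coeff i).eval (RingHom.id ℂ) (qpow η 1) * qpow η (i * x)

end QuantumTrace

end

/-!
The intertwining operator `Φ` takes the highest weight vector to a singular vector
`∑_j c_j F ^ j v_μ ⊗ w_(k - j)` of `M_μ ⊗ U`, and takes `F ^ i v_μ` to the image of that vector
under `Δ(F) ^ i`. Since the two summands of `Δ(F)` commute up to a power of `q`, the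
`q`-binomial theorem gives the diagonal entries of `Φ`, hence the trace as a power series in
`z = q ^ (-2 ν)`. With `p = q ^ (-2)`, the `q`-Chu–Vandermonde identity turns the coefficient of
`z ^ m`, up to a factor that does not depend on `m`, into
`∏_{l < k} (1 - p ^ (l + 1 + m)) (1 - q ^ (-2 μ) p ^ (-(l + m)))`. This is a combination of the
geometric progressions `p ^ (m (k - s))`, `0 ≤ s ≤ 2 k`, so that the series sums to partial
fractions in `z`, and these are the analytic continuation `Ψ`.

Replacing `μ = n - 1` by `μ = -n - 1` multiplies the numerator of each partial fraction by an
`n`-th power, which truncates each geometric series after `n` terms. The difference is therefore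
a finite sum of the same coefficients at `μ = n - 1`, of which the `k` last vanish; the others
are the coefficients of the polynomials of Rogers.

It remains to see that the polynomials of Rogers are the Macdonald polynomials. The weight with
parameter `k + 1` is the symmetrization of `w = (1 - T ^ 2) ∏ (1 - q ^ (2 l) T ^ (±2))`,
`1 ≤ l ≤ k`, which is a monomial times `∏_{|l| ≤ k} (1 - q ^ (2 l) T ^ 2)`. Multiplication by
the latter acts on the coefficients as a difference operator that annihilates the progressions
`q ^ (2 l j)`, `|l| ≤ k`, and the `j`-th coefficient of a Rogers polynomial is a combination of
these. Hence `P_N w` has no terms of degree `i` with `-N < i ≤ N`, and `P_N` is orthogonal to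
`P_m` for `m < N`.
-/

noncomputable section

namespace QuantumTrace

open Finset

section QBinomial

/-! ### Gaussian binomial coefficients -/

/-- The Gaussian binomial coefficient, over any commutative semiring by the `q`-Pascal rule. -/
def qBinom {R : Type*} [CommSemiring R] (q : R) : ℕ → ℕ → R
  | _, 0 => 1
  | 0, _ + 1 => 0
  | n + 1, r + 1 => qBinom q n r + q ^ (r + 1) * qBinom q n (r + 1)

section CommSemiring

variable {R : Type*} [CommSemiring R] (q : R)

@[simp] theorem qBinom_zero_right (n : ℕ) : qBinom q n 0 = 1 := by cases n <;> rfl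

theorem qBinom_succ_succ (n r : ℕ) :
    qBinom q (n + 1) (r + 1) = qBinom q n r + q ^ (r + 1) * qBinom q n (r + 1) := rfl

theorem qBinom_eq_zero_of_lt {n r : ℕ} (h : n < r) : qBinom q n r = 0 := by
  induction n generalizing r with
  | zero => obtain ⟨r, rfl⟩ := Nat.exists_eq_succ_of_ne_zero h.ne'; rfl
  | succ n ih =>
    obtain ⟨r, rfl⟩ := Nat.exists_eq_succ_of_ne_zero (Nat.ne_zero_of_lt h)
    rw [Nat.succ_eq_add_one, qBinom_succ_succ, ih (by lia), ih (by lia), mul_zero, add_zero]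

@[simp] theorem qBinom_self (n : ℕ) : qBinom q n n = 1 := by
  induction n with
  | zero => rfl
  | succ n ih =>
    rw [qBinom_succ_succ, ih, qBinom_eq_zero_of_lt q n.lt_succ_self, mul_zero, add_zero]

theorem qBinom_mul_pow_eq_sum_antidiagonal (z : R) (r i : ℕ) :
    qBinom q (i + (r + 1)) (r + 1) * z ^ i =
      ∑ x ∈ antidiagonal i, qBinom q (x.1 + r) r * z ^ x.1 * (q ^ (r + 1) * z) ^ x.2 := by
  induction i with
  | zero => simp
  | succ i ih =>
    calc qBinom q (i + 1 + (r + 1)) (r + 1) * z ^ (i + 1)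
        = qBinom q (i + 1 + r) r * z ^ (i + 1) +
            q ^ (r + 1) * z * (qBinom q (i + (r + 1)) (r + 1) * z ^ i) := by
          rw [← add_assoc (i + 1), qBinom_succ_succ, show i + 1 + r = i + (r + 1) by ring]
          ring
      _ = _ := by
          rw [ih, Nat.sum_antidiagonal_succ', mul_sum, pow_zero, mul_one]
          refine congrArg _ (sum_congr rfl fun x _ => ?_)
          rw [pow_succ (q ^ (r + 1) * z)]
          ring

theorem pow_mul_of_q_commute {A : Type*} [Semiring A] [Algebra R A] {q : R} {x y : A}
    (h : y * x = q • (x * y)) (r : ℕ) : y ^ r * x = q ^ r • (x * y ^ r) := by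
  induction r with
  | zero => simp
  | succ r ih =>
    rw [pow_succ, mul_assoc, h, mul_smul_comm, ← mul_assoc, ih, smul_mul_assoc, smul_smul,
      mul_assoc, ← pow_succ']

theorem add_pow_of_q_commute {A : Type*} [Semiring A] [Algebra R A] {q : R} {x y : A}
    (h : y * x = q • (x * y)) (n : ℕ) :
    (x + y) ^ n = ∑ r ∈ range (n + 1), qBinom q n r • (x ^ (n - r) * y ^ r) := by
  induction n with
  | zero => simp
  | succ n ih =>
    have mul_add_term : ∀ r ∈ range (n + 1), qBinom q n r • (x ^ (n - r) * y ^ r) * (x + y) =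
        (q ^ r * qBinom q n r) • (x ^ (n + 1 - r) * y ^ r) +
          qBinom q n r • (x ^ (n - r) * y ^ (r + 1)) := by
      intro r hr
      rw [mul_add, smul_mul_assoc, smul_mul_assoc, mul_assoc, pow_mul_of_q_commute h,
        mul_smul_comm, smul_smul, ← mul_assoc, ← pow_succ, mul_assoc, ← pow_succ,
        Nat.succ_sub (mem_range_succ_iff.1 hr), mul_comm (qBinom q n r)]
    have last_term : (q ^ (n + 1) * qBinom q n (n + 1)) • (x ^ (n - n) * y ^ (n + 1)) = 0 := by
      rw [qBinom_eq_zero_of_lt q n.lt_succ_self, mul_zero, zero_smul]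
    rw [pow_succ, ih, sum_mul, sum_congr rfl mul_add_term, sum_add_distrib, sum_range_succ',
      sum_range_succ' _ (n + 1)]
    simp only [qBinom_succ_succ, add_smul, sum_add_distrib, Nat.add_sub_add_right,
      qBinom_zero_right, pow_zero, mul_one, Nat.sub_zero]
    rw [sum_range_succ (fun r => (q ^ (r + 1) * qBinom q n (r + 1)) • (x ^ (n - r) * y ^ (r + 1))),
      last_term]
    abel

end CommSemiring

section CommRing

variable {R : Type*} [CommRing R] (q : R)

theorem qBinom_succ_right_mul (n r : ℕ) :
    qBinom q n (r + 1) * (1 - q ^ (r + 1)) = qBinom q n r * (1 - q ^ (n - r)) := by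
  induction n generalizing r with
  | zero => rw [qBinom_eq_zero_of_lt q r.succ_pos, Nat.zero_sub, pow_zero, sub_self]; ring
  | succ n ih =>
    rcases r with _ | r
    · have := ih 0
      simp only [qBinom_succ_succ, qBinom_zero_right, Nat.sub_zero, zero_add] at this ⊢
      linear_combination q * this
    · rw [qBinom_succ_succ, qBinom_succ_succ, Nat.add_sub_add_right]
      rcases lt_or_ge n (r + 1) with hr | hr
      · rw [qBinom_eq_zero_of_lt q hr, qBinom_eq_zero_of_lt q (hr.trans r.succ.lt_succ_self),
          Nat.sub_eq_zero_of_le (Nat.lt_succ_iff.1 hr)]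
        ring
      · obtain ⟨d, rfl⟩ := Nat.exists_eq_add_of_le hr
        have ih₀ := ih r
        have ih₁ := ih (r + 1)
        rw [show r + 1 + d - r = d + 1 by lia] at ih₀ ⊢
        rw [show r + 1 + d - (r + 1) = d by lia] at ih₁
        linear_combination q ^ (r + 2) * ih₁ + ih₀

theorem qBinom_succ_succ' (n r : ℕ) :
    qBinom q (n + 1) (r + 1) = q ^ (n - r) * qBinom q n r + qBinom q n (r + 1) := by
  linear_combination qBinom_succ_succ q n r - qBinom_succ_right_mul q n r

theorem qBinom_add_mul_prod (n r : ℕ) :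
    qBinom q (n + r) r * ∏ l ∈ range r, (1 - q ^ (l + 1)) =
      ∏ l ∈ range r, (1 - q ^ (n + l + 1)) := by
  induction r generalizing n with
  | zero => simp
  | succ r ih =>
    have step := qBinom_succ_right_mul q (n + (r + 1)) r
    rw [show n + (r + 1) - r = n + 1 by lia] at step
    calc qBinom q (n + (r + 1)) (r + 1) * ∏ l ∈ range (r + 1), (1 - q ^ (l + 1))
        = (1 - q ^ (n + 1)) * (qBinom q (n + 1 + r) r * ∏ l ∈ range r, (1 - q ^ (l + 1))) := by
          rw [prod_range_succ, show n + 1 + r = n + (r + 1) by ring]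
          linear_combination (∏ l ∈ range r, (1 - q ^ (l + 1))) * step
      _ = ∏ l ∈ range (r + 1), (1 - q ^ (n + l + 1)) := by
          rw [ih, prod_range_succ', mul_comm, add_zero]
          simp only [add_right_comm n, add_assoc]

theorem q_chu_vandermonde (a b : R) (k : ℕ) :
    ∏ l ∈ range k, (1 - a * b * q ^ l) =
      ∑ j ∈ range (k + 1), qBinom q k j * b ^ j *
        (∏ l ∈ range j, (1 - a * q ^ l)) * ∏ l ∈ range (k - j), (1 - b * q ^ l) := by
  induction k with
  | zero => simp
  | succ k ih =>
    set A : ℕ → R := fun j => ∏ l ∈ range j, (1 - a * q ^ l)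
    set B : ℕ → R := fun j => ∏ l ∈ range j, (1 - b * q ^ l)
    have A_succ (j) : A (j + 1) = A j * (1 - a * q ^ j) := prod_range_succ _ _
    have B_succ (j) : B (j + 1) = B j * (1 - b * q ^ j) := prod_range_succ _ _
    let U : ℕ → R := fun j => q ^ (k - j) * qBinom q k j * b ^ (j + 1) * A (j + 1) * B (k - j)
    let V : ℕ → R := fun j => qBinom q k j * b ^ j * A j * B (k + 1 - j)
    have V_last : V (k + 1) = 0 := by simp [V, qBinom_eq_zero_of_lt]
    have old_term (j) (hj : j ∈ range (k + 1)) :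
        qBinom q k j * b ^ j * A j * B (k - j) * (1 - a * b * q ^ k) = U j + V j := by
      obtain ⟨d, rfl⟩ := Nat.exists_eq_add_of_le (mem_range_succ_iff.1 hj)
      simp only [U, V]
      rw [Nat.add_sub_cancel_left, add_assoc j, Nat.add_sub_cancel_left, A_succ, B_succ]
      ring
    have new_term (j) : qBinom q (k + 1) (j + 1) * b ^ (j + 1) * A (j + 1) * B (k + 1 - (j + 1)) =
        U j + V (j + 1) := by
      simp only [U, V, qBinom_succ_succ', Nat.add_sub_add_right]
      ring
    calc ∏ l ∈ range (k + 1), (1 - a * b * q ^ l)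
        = ∑ j ∈ range (k + 1), U j + (∑ j ∈ range (k + 1), V j + V (k + 1)) := by
          rw [prod_range_succ, ih, sum_mul, sum_congr rfl old_term, sum_add_distrib, V_last,
            add_zero]
      _ = ∑ j ∈ range (k + 1), (U j + V (j + 1)) + V 0 := by
          rw [← sum_range_succ V, sum_range_succ' V, ← add_assoc, sum_add_distrib]
      _ = _ := by
          rw [sum_range_succ' _ (k + 1), sum_congr rfl fun j _ => (new_term j).symm]
          simp [V, A, B]

end CommRing

theorem prod_one_sub_pow_mul_inv_pow_mul {K : Type*} [Field K] {q : K} (hq : q ≠ 0) (z : K)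
    (j k : ℕ) :
    ∏ l ∈ range (k + j + 1), (1 - q ^ l * (q⁻¹ ^ j * z)) =
      (∏ l ∈ range (j + 1), (1 - q⁻¹ ^ l * z)) * ∏ l ∈ range k, (1 - q ^ (l + 1) * z) := by
  have cancel (l d : ℕ) : q ^ (l + d) * q⁻¹ ^ d = q ^ l := by
    rw [pow_add, mul_assoc, ← mul_pow, mul_inv_cancel₀ hq, one_pow, mul_one]
  rw [show k + j + 1 = j + 1 + k by lia, prod_range_add, ← prod_range_reflect _ (j + 1)]
  congr 1 <;> refine prod_congr rfl fun l hl => ?_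
  · obtain ⟨d, rfl⟩ := Nat.exists_eq_add_of_le (mem_range_succ_iff.1 hl)
    rw [show l + d + 1 - 1 - l = d by lia, ← mul_assoc, add_comm l, pow_add q⁻¹, ← mul_assoc,
      ← mul_pow, mul_inv_cancel₀ hq, one_pow, one_mul]
  · rw [← mul_assoc, show j + 1 + l = l + 1 + j by lia, cancel]

section Series

variable {𝕜 : Type*} [NormedField 𝕜] {q z : 𝕜}

theorem norm_pow_mul_lt_one (hq : ‖q‖ ≤ 1) (hz : ‖z‖ < 1) (r : ℕ) : ‖q ^ r * z‖ < 1 := by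
  rw [norm_mul, norm_pow]
  exact (mul_le_of_le_one_left (norm_nonneg _) (pow_le_one₀ (norm_nonneg _) hq)).trans_lt hz

theorem summable_norm_qBinom_mul_pow (hq : ‖q‖ ≤ 1) (hz : ‖z‖ < 1) (r : ℕ) :
    Summable fun i : ℕ => ‖qBinom q (i + r) r * z ^ i‖ := by
  induction r with
  | zero => simpa using summable_geometric_of_lt_one (norm_nonneg z) hz
  | succ r ih =>
    refine (summable_norm_sum_mul_antidiagonal_of_summable_norm ih
      (summable_norm_geometric_of_norm_lt_one (norm_pow_mul_lt_one hq hz (r + 1)))).congr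
      fun i => ?_
    rw [qBinom_mul_pow_eq_sum_antidiagonal]

variable [CompleteSpace 𝕜]

theorem hasSum_qBinom_add_mul_pow (hq : ‖q‖ ≤ 1) (hz : ‖z‖ < 1) (r : ℕ) :
    HasSum (fun i : ℕ => qBinom q (i + r) r * z ^ i) (∏ l ∈ range (r + 1), (1 - q ^ l * z))⁻¹ := by
  induction r with
  | zero => simpa using hasSum_geometric_of_norm_lt_one hz
  | succ r ih =>
    have hz' := norm_pow_mul_lt_one hq hz (r + 1)
    have cauchy := tsum_mul_tsum_eq_tsum_sum_antidiagonal_of_summable_norm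
      (summable_norm_qBinom_mul_pow hq hz r) (summable_norm_geometric_of_norm_lt_one hz')
    simp only [ih.tsum_eq, tsum_geometric_of_norm_lt_one hz',
      ← qBinom_mul_pow_eq_sum_antidiagonal] at cauchy
    rw [prod_range_succ, mul_inv, cauchy]
    exact (summable_norm_qBinom_mul_pow hq hz (r + 1)).of_norm.hasSum

theorem hasSum_qBinom_mul_pow (hq : ‖q‖ ≤ 1) (hz : ‖z‖ < 1) (r : ℕ) :
    HasSum (fun i : ℕ => qBinom q i r * z ^ i)
      (z ^ r * (∏ l ∈ range (r + 1), (1 - q ^ l * z))⁻¹) := by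
  have vanish : ∑ i ∈ range r, qBinom q i r * z ^ i = 0 :=
    sum_eq_zero fun i hi => by rw [qBinom_eq_zero_of_lt q (mem_range.1 hi), zero_mul]
  rw [← add_zero (z ^ r * _), ← vanish, ← hasSum_nat_add_iff]
  exact ((hasSum_qBinom_add_mul_pow hq hz r).mul_left (z ^ r)).congr_fun fun i => by
    rw [pow_add]; ring

theorem hasSum_zpow_mul_qBinom_mul_pow (hq : ‖q‖ = 1) (hz : ‖z‖ < 1) (j k : ℕ) :
    HasSum (fun m : ℕ => q ^ (-(j * (m - j)) : ℤ) * qBinom q (m + k) (k + j) * z ^ m)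
      (z ^ j * (∏ l ∈ range (j + 1), (1 - q⁻¹ ^ l * z))⁻¹ *
        (∏ l ∈ range k, (1 - q ^ (l + 1) * z))⁻¹) := by
  have hq0 : q ≠ 0 := norm_ne_zero_iff.1 (hq.trans_ne one_ne_zero)
  have vanish : ∑ m ∈ range j,
      q ^ (-(j * (m - j)) : ℤ) * qBinom q (m + k) (k + j) * z ^ m = 0 :=
    sum_eq_zero fun m hm => by
      rw [qBinom_eq_zero_of_lt q (by have := mem_range.1 hm; lia), mul_zero, zero_mul]
  have shifted : ‖q⁻¹ ^ j * z‖ < 1 := norm_pow_mul_lt_one (by rw [norm_inv, hq, inv_one]) hz j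
  rw [mul_assoc, ← mul_inv, ← prod_one_sub_pow_mul_inv_pow_mul hq0, ← add_zero (z ^ j * _),
    ← vanish, ← hasSum_nat_add_iff]
  refine ((hasSum_qBinom_add_mul_pow hq.le shifted (k + j)).mul_left (z ^ j)).congr_fun fun i => ?_
  rw [add_assoc i, add_comm j k, mul_pow, ← pow_mul, inv_pow, ← zpow_natCast q (j * i), ← zpow_neg,
    pow_add z, show (-(j * ((i + j : ℕ) - j)) : ℤ) = -((j * i : ℕ) : ℤ) by push_cast; ring]
  ring

end Series

end QBinomial

section TraceCoefficient

theorem prod_one_sub_mul_mul_pow_term_succ {R : Type*} [CommRing R] (q a b : R) {k j : ℕ}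
    (hj : j < k) :
    qBinom q k (j + 1) * b ^ (j + 1) * (∏ l ∈ range (j + 1), (1 - a * q ^ l)) *
        (∏ l ∈ range (k - (j + 1)), (1 - b * q ^ l)) *
          ((1 - q ^ (j + 1)) * (1 - b * q ^ (k - 1 - j))) =
      qBinom q k j * b ^ j * (∏ l ∈ range j, (1 - a * q ^ l)) *
        (∏ l ∈ range (k - j), (1 - b * q ^ l)) * (b * (1 - a * q ^ j) * (1 - q ^ (k - j))) := by
  rw [show k - j = k - (j + 1) + 1 by lia, prod_range_succ _ j, prod_range_succ _ (k - (j + 1)),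
    show k - (j + 1) + 1 = k - j by lia, show k - (j + 1) = k - 1 - j by lia]
  linear_combination b ^ (j + 1) * (∏ l ∈ range j, (1 - a * q ^ l)) * (1 - a * q ^ j) *
    (∏ l ∈ range (k - 1 - j), (1 - b * q ^ l)) * (1 - b * q ^ (k - 1 - j)) *
      qBinom_succ_right_mul q k j

variable {K : Type*} [Field K] {p M : K} {k : ℕ} {d : ℕ → K}

theorem prod_one_sub_mul_zpow_neg (hp : p ≠ 0) (x : K) (k : ℕ) :
    ∏ l ∈ range k, (1 - x * p ^ (-l : ℤ)) = ∏ l ∈ range k, (1 - x * p ^ (1 - k : ℤ) * p ^ l) := by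
  rw [← prod_range_reflect]
  refine prod_congr rfl fun l hl => ?_
  rw [mul_assoc, ← zpow_natCast, ← zpow_add₀ hp,
    show -((k - 1 - l : ℕ) : ℤ) = 1 - k + l by have := mem_range.1 hl; lia]

theorem qBinom_succ_right_mul_zpow (p : K) (m k j : ℕ) :
    qBinom p (m + k) (k + j + 1) * (1 - p ^ (k + j + 1)) =
      qBinom p (m + k) (k + j) * (1 - p ^ (m - j : ℤ)) := by
  rw [qBinom_succ_right_mul]
  rcases lt_or_ge m j with h | h
  · rw [qBinom_eq_zero_of_lt p (show m + k < k + j by lia), zero_mul, zero_mul]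
  · rw [← zpow_natCast, show ((m + k - (k + j) : ℕ) : ℤ) = (m - j : ℤ) by lia]

theorem zpow_neg_mul_sub_succ (hp : p ≠ 0) (m k j : ℕ) :
    p ^ (-((j + 1 : ℕ) * (m - (j + 1 : ℕ))) : ℤ) * p ^ (-(k + j : ℤ)) * (1 - p ^ (m - j : ℤ)) =
      -(p ^ (-(j * (m - j)) : ℤ) * p ^ (1 - k : ℤ) * (1 - p ^ (-m : ℤ) * p ^ j)) := by
  have exponents : p ^ (-((j + 1 : ℕ) * (m - (j + 1 : ℕ))) : ℤ) * p ^ (-(k + j : ℤ)) =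
      p ^ (-(j * (m - j)) : ℤ) * p ^ (1 - k : ℤ) * p ^ (-m + j : ℤ) := by
    simp only [← zpow_add₀ hp]
    congr 1; push_cast; ring
  have inverse : p ^ (-m + j : ℤ) * p ^ (m - j : ℤ) = 1 := by
    rw [← zpow_add₀ hp, show (-m + j + (m - j) : ℤ) = 0 by ring, zpow_zero]
  rw [← zpow_natCast p j, ← zpow_add₀ hp (-m)]
  linear_combination (1 - p ^ (m - j : ℤ)) * exponents -
    p ^ (-(j * (m - j)) : ℤ) * p ^ (1 - k : ℤ) * inverse

theorem trace_term_eq_vandermonde_term (hp : p ≠ 0) (hd0 : d 0 = 1)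
    (hp1 : ∀ j, j < 2 * k → 1 - p ^ (j + 1) ≠ 0)
    (hM : ∀ j : ℕ, j < k → 1 - M * p ^ (-j : ℤ) ≠ 0)
    (hd : ∀ j, j < k → d (j + 1) * (1 - p ^ (j + 1)) * (1 - M * p ^ (-j : ℤ)) =
      -(M * p ^ (-(k + j : ℤ))) * (1 - p ^ (k - j)) * (1 - p ^ (k + j + 1)) * d j)
    (m : ℕ) {j : ℕ} (hj : j ≤ k) :
    (∏ l ∈ range k, (1 - M * p ^ (-l : ℤ))) *
        (d j * (p ^ (-(j * (m - j)) : ℤ) * qBinom p (m + k) (k + j))) =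
      qBinom p (m + k) k * (qBinom p k j * (M * p ^ (1 - k : ℤ)) ^ j *
        (∏ l ∈ range j, (1 - p ^ (-m : ℤ) * p ^ l)) *
          ∏ l ∈ range (k - j), (1 - M * p ^ (1 - k : ℤ) * p ^ l)) := by
  induction j with
  | zero =>
    rw [prod_one_sub_mul_zpow_neg hp, hd0]
    simp [mul_comm]
  | succ j ih =>
    have ih := ih (by lia)
    have hN := hp1 (k + j) (by lia)
    have left_ratio :
        d (j + 1) * (p ^ (-((j + 1 : ℕ) * (m - (j + 1 : ℕ))) : ℤ) *
            qBinom p (m + k) (k + j + 1)) * ((1 - p ^ (j + 1)) * (1 - M * p ^ (-j : ℤ))) =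
          d j * (p ^ (-(j * (m - j)) : ℤ) * qBinom p (m + k) (k + j)) *
            (M * p ^ (1 - k : ℤ) * (1 - p ^ (-m : ℤ) * p ^ j) * (1 - p ^ (k - j))) := by
      refine mul_right_cancel₀ hN ?_
      set Z := p ^ (-((j + 1 : ℕ) * (m - (j + 1 : ℕ))) : ℤ)
      set Q := qBinom p (m + k) (k + j)
      linear_combination Z * qBinom p (m + k) (k + j + 1) * (1 - p ^ (k + j + 1)) *
          hd j (by lia) -
        M * Z * p ^ (-(k + j : ℤ)) * (1 - p ^ (k - j)) * (1 - p ^ (k + j + 1)) * d j *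
          qBinom_succ_right_mul_zpow p m k j -
        M * Q * (1 - p ^ (k - j)) * (1 - p ^ (k + j + 1)) * d j * zpow_neg_mul_sub_succ hp m k j
    have right_ratio := prod_one_sub_mul_mul_pow_term_succ p (p ^ (-m : ℤ))
      (M * p ^ (1 - k : ℤ)) (show j < k by lia)
    rw [mul_assoc M, ← zpow_natCast p (k - 1 - j), ← zpow_add₀ hp,
      show (1 - k + (k - 1 - j : ℕ) : ℤ) = -j by lia] at right_ratio
    refine mul_right_cancel₀ (mul_ne_zero (hp1 j (by lia)) (hM j (by lia))) ?_
    rw [← add_assoc k, mul_assoc, left_ratio, mul_assoc (qBinom p (m + k) k), right_ratio,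
      ← mul_assoc, ih, mul_assoc (qBinom p (m + k) k)]

theorem sum_trace_term (hp : p ≠ 0) (hd0 : d 0 = 1)
    (hp1 : ∀ j, j < 2 * k → 1 - p ^ (j + 1) ≠ 0)
    (hM : ∀ j : ℕ, j < k → 1 - M * p ^ (-j : ℤ) ≠ 0)
    (hd : ∀ j, j < k → d (j + 1) * (1 - p ^ (j + 1)) * (1 - M * p ^ (-j : ℤ)) =
      -(M * p ^ (-(k + j : ℤ))) * (1 - p ^ (k - j)) * (1 - p ^ (k + j + 1)) * d j) (m : ℕ) :
    (∏ l ∈ range k, (1 - p ^ (l + 1))) * ((∏ l ∈ range k, (1 - M * p ^ (-l : ℤ))) *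
        ∑ j ∈ range (k + 1), d j * (p ^ (-(j * (m - j)) : ℤ) * qBinom p (m + k) (k + j))) =
      ∏ l ∈ range k, ((1 - p ^ (l + 1 + m)) * (1 - M * p ^ (-(l + m) : ℤ))) := by
  have reflected : ∏ l ∈ range k, (1 - M * p ^ (-(l + m) : ℤ)) =
      ∏ l ∈ range k, (1 - p ^ (-m : ℤ) * (M * p ^ (1 - k : ℤ)) * p ^ l) := by
    rw [← mul_assoc, mul_comm (p ^ (-m : ℤ)) M, ← prod_one_sub_mul_zpow_neg hp]
    simp only [neg_add_rev, zpow_add₀ hp, mul_assoc]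
  rw [mul_sum, sum_congr rfl fun j hj => trace_term_eq_vandermonde_term hp hd0 hp1 hM hd m
      (mem_range_succ_iff.1 hj), ← mul_sum, ← q_chu_vandermonde, ← mul_assoc,
    mul_comm (∏ l ∈ range k, _), qBinom_add_mul_prod, prod_mul_distrib, reflected]
  exact congrArg (· * _) (prod_congr rfl fun l _ => by
    rw [add_comm m, add_right_comm])

end TraceCoefficient

section QPow

/-! ### Verma modules and their intertwining operators -/

variable {η x : ℂ}

theorem qpow_ne_zero (η x : ℂ) : qpow η x ≠ 0 := Complex.exp_ne_zero _

theorem qpow_neg (η x : ℂ) : qpow η (-x) = (qpow η x)⁻¹ := by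
  rw [qpow, mul_neg, Complex.exp_neg, qpow]

theorem qpow_neg_left (η x : ℂ) : qpow (-η) x = qpow η (-x) := by rw [qpow, qpow, neg_mul_comm]

theorem qpow_nat_mul (η x : ℂ) (n : ℕ) : qpow η (n * x) = qpow η x ^ n := by
  rw [qpow, qpow, ← Complex.exp_nat_mul, mul_left_comm]

theorem qpow_int_mul (η x : ℂ) (n : ℤ) : qpow η (n * x) = qpow η x ^ n := by
  rw [qpow, qpow, ← Complex.exp_int_mul, mul_left_comm]

theorem qpow_neg_ne_one (h : qpow η x ≠ 1) : qpow η (-x) ≠ 1 := by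
  rwa [qpow_neg, ne_eq, inv_eq_one]

theorem qpow_sub_qpow_neg (η x : ℂ) :
    qpow η x - qpow η (-x) = qpow η x * (1 - qpow η (-(2 * x))) := by
  rw [mul_sub, mul_one, ← qpow_add, show x + -(2 * x) = -x by ring]

theorem qpow_sub_qpow_neg_ne_zero (h : qpow η (2 * x) ≠ 1) : qpow η x - qpow η (-x) ≠ 0 := by
  rw [qpow_sub_qpow_neg]
  exact mul_ne_zero (qpow_ne_zero _ _) (sub_ne_zero.2 (qpow_neg_ne_one h).symm)

theorem qnum_ne_zero (hη : qpow η 2 ≠ 1) (h : qpow η (2 * x) ≠ 1) : qnum η x ≠ 0 :=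
  div_ne_zero (qpow_sub_qpow_neg_ne_zero h) (qpow_sub_qpow_neg_ne_zero (by rwa [mul_one]))

theorem ne_zero_of_qpow_ne_one (h : qpow η x ≠ 1) : η ≠ 0 := by
  rintro rfl
  exact h (by rw [qpow, zero_mul, Complex.exp_zero])

theorem eq_of_forall_qpow_mul_eq {y : ℂ} (hη : η ≠ 0) (h : ∀ c, qpow η (c * x) = qpow η (c * y)) :
    x = y := by
  by_contra hxy
  have hxy' : η * (x - y) ≠ 0 := mul_ne_zero hη (sub_ne_zero.2 hxy)
  have exp_one : qpow η ((η * (x - y))⁻¹ * (x - y)) = 1 := by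
    rw [mul_sub, sub_eq_add_neg, qpow_add, h, qpow_neg, mul_inv_cancel₀ (qpow_ne_zero _ _)]
  rw [qpow, mul_left_comm, inv_mul_cancel₀ hxy'] at exp_one
  have norm_exp_one := congrArg norm exp_one
  rw [Complex.norm_exp, Complex.one_re, norm_one, Real.exp_eq_one_iff] at norm_exp_one
  exact one_ne_zero norm_exp_one

end QPow

section Basis

variable (η μ : ℂ)

@[simp] theorem verma_F_single (i : ℕ) :
    (verma η μ).F (Finsupp.single i 1) = Finsupp.single (i + 1) 1 := by simp [verma]

theorem verma_E_single (i : ℕ) : (verma η μ).E (Finsupp.single i 1) =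
    (qnum η i * qnum η (μ - i + 1)) • Finsupp.single (i - 1) 1 := by simp [verma]

@[simp] theorem verma_E_single_zero : (verma η μ).E (Finsupp.single 0 1) = 0 := by
  simp [verma, qnum_zero]

@[simp] theorem verma_K_single (c : ℂ) (i : ℕ) : (verma η μ).K c (Finsupp.single i 1) =
    qpow η (c * (μ - 2 * i)) • Finsupp.single i 1 := by simp [verma]

theorem verma_F_pow_single (r j : ℕ) :
    ((verma η μ).F ^ r) (Finsupp.single j 1) = Finsupp.single (j + r) 1 := by
  induction r with
  | zero => simp
  | succ r ih => rw [pow_succ', Module.End.mul_apply, ih, verma_F_single, add_assoc]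

theorem verma_K_pow_single (c : ℂ) (r j : ℕ) :
    ((verma η μ).K c ^ r) (Finsupp.single j 1) =
      qpow η (r * (c * (μ - 2 * j))) • Finsupp.single j 1 := by
  induction r with
  | zero => simp [qpow_zero]
  | succ r ih =>
    rw [pow_succ', Module.End.mul_apply, ih, map_smul, verma_K_single, smul_smul, ← qpow_add,
      Nat.cast_succ, add_one_mul]

/-- The vector of index `a` of the basis of `irrep η d`. It is zero for `d < a`, so that
`F` always raises the index. -/
def irrepVec (d a : ℕ) : Fin (d + 1) → ℂ := fun i => if i.val = a then 1 else 0

@[simp] theorem irrep_F_irrepVec (d a : ℕ) :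
    (irrep η d).F (irrepVec d a) = irrepVec d (a + 1) := by
  funext i
  by_cases h : 0 < i.val
  · have index : i.val - 1 = a ↔ i.val = a + 1 := by lia
    simp only [irrep, irrepVec, LinearMap.pi_apply, if_pos h, LinearMap.proj_apply, index]
  · have index : i.val ≠ a + 1 := by lia
    simp only [irrep, irrepVec, LinearMap.pi_apply, if_neg h, LinearMap.zero_apply, if_neg index]

theorem irrep_F_pow_irrepVec (d r a : ℕ) :
    ((irrep η d).F ^ r) (irrepVec d a) = irrepVec d (a + r) := by
  induction r with
  | zero => simp
  | succ r ih => rw [pow_succ', Module.End.mul_apply, ih, irrep_F_irrepVec, add_assoc]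

theorem irrep_K_apply (c : ℂ) (d : ℕ) (w : Fin (d + 1) → ℂ) (a : Fin (d + 1)) :
    (irrep η d).K c w a = qpow η (c * (d - 2 * (a.val : ℂ))) * w a := rfl

@[simp] theorem irrep_K_irrepVec (c : ℂ) (d a : ℕ) :
    (irrep η d).K c (irrepVec d a) = qpow η (c * (d - 2 * a)) • irrepVec d a := by
  funext i
  simp only [irrep_K_apply, irrepVec, Pi.smul_apply, smul_eq_mul]
  split_ifs with h
  · rw [h]
  · rw [mul_zero, mul_zero]

theorem irrep_K_irrepVec_middle (c : ℂ) (k : ℕ) :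
    (irrep η (2 * k)).K c (irrepVec (2 * k) k) = irrepVec (2 * k) k := by
  rw [irrep_K_irrepVec, Nat.cast_mul, Nat.cast_two, sub_self, mul_zero, qpow_zero, one_smul]

@[simp] theorem irrep_E_irrepVec_zero (d : ℕ) : (irrep η d).E (irrepVec d 0) = 0 := by
  funext i
  simp only [irrep, LinearMap.pi_apply]
  split_ifs with h <;> simp [irrepVec]

theorem irrep_E_irrepVec_succ {d a : ℕ} (ha : a < d) : (irrep η d).E (irrepVec d (a + 1)) =
    (qnum η (a + 1) * qnum η (d - a)) • irrepVec d a := by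
  funext i
  simp only [irrep, LinearMap.pi_apply, Pi.smul_apply]
  split_ifs with h
  · rcases eq_or_ne i.val a with hi | hi <;> simp [irrepVec, hi]
  · simp [irrepVec, show i.val ≠ a by lia]

end Basis

section VermaLift

variable {η μ : ℂ} {W : Type*} [AddCommGroup W] [Module ℂ W] {B : UqModule η W}

/-- The linear map from a Verma module that takes `F ^ i v` to `F ^ i s`. -/
def vermaLift (B : UqModule η W) (s : W) : (ℕ →₀ ℂ) →ₗ[ℂ] W :=
  Finsupp.linearCombination ℂ fun i : ℕ => (B.F ^ i) s

@[simp] theorem vermaLift_single (B : UqModule η W) (s : W) (i : ℕ) :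
    vermaLift B s (Finsupp.single i 1) = (B.F ^ i) s := by
  simp [vermaLift]

theorem vermaLift_comp_F (B : UqModule η W) (s : W) :
    vermaLift B s ∘ₗ (verma η μ).F = B.F ∘ₗ vermaLift B s := by
  ext i
  simp [pow_succ']

theorem isUqHom_vermaLift {s : W} (hE : B.E s = 0) (hK : ∀ c, B.K c s = qpow η (c * μ) • s) :
    IsUqHom (verma η μ) B (vermaLift B s) := by
  have hF (x) : vermaLift B s ((verma η μ).F x) = B.F (vermaLift B s x) :=
    LinearMap.congr_fun (vermaLift_comp_F B s) x
  have hK' (c i) : vermaLift B s ((verma η μ).K c (Finsupp.single i 1)) =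
      B.K c (vermaLift B s (Finsupp.single i 1)) := by
    induction i with
    | zero =>
      rw [verma_K_single, map_smul, vermaLift_single, pow_zero, Module.End.one_apply, hK,
        Nat.cast_zero, mul_zero, sub_zero]
    | succ i ih =>
      rw [← verma_F_single η μ, ← Module.End.mul_apply, UqModule.K_mul_F, hF,
        ← Module.End.mul_apply (B.K c), UqModule.K_mul_F]
      simp only [LinearMap.smul_apply, Module.End.mul_apply, map_smul, hF, ih]
  have hE' (i) : vermaLift B s ((verma η μ).E (Finsupp.single i 1)) =
      B.E (vermaLift B s (Finsupp.single i 1)) := by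
    induction i with
    | zero => simp [hE]
    | succ i ih =>
      have commutator := LinearMap.congr_fun (verma η μ).E_F (Finsupp.single i 1)
      have commutator' := LinearMap.congr_fun B.E_F (vermaLift B s (Finsupp.single i 1))
      simp only [LinearMap.sub_apply, Module.End.mul_apply, LinearMap.smul_apply,
        sub_eq_iff_eq_add] at commutator commutator'
      rw [← verma_F_single η μ, commutator, hF, commutator', map_add, map_smul, map_sub, hK', hK',
        hF, ih]
  refine ⟨?_, vermaLift_comp_F B s, fun c => ?_⟩
  · ext i; simpa using hE' i
  · ext i; simpa using hK' c i

theorem IsUqHom.verma_ext {φ φ' : (ℕ →₀ ℂ) →ₗ[ℂ] W} (h : IsUqHom (verma η μ) B φ)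
    (h' : IsUqHom (verma η μ) B φ') (h0 : φ (Finsupp.single 0 1) = φ' (Finsupp.single 0 1)) :
    φ = φ' := by
  ext i : 2
  simp only [LinearMap.comp_apply, Finsupp.lsingle_apply]
  induction i with
  | zero => exact h0
  | succ i ih =>
    have hF := LinearMap.congr_fun h.2.1 (Finsupp.single i 1)
    have hF' := LinearMap.congr_fun h'.2.1 (Finsupp.single i 1)
    simp only [LinearMap.comp_apply, verma_F_single] at hF hF'
    rw [hF, hF', ih]

theorem IsUqHom.E_highest {φ : (ℕ →₀ ℂ) →ₗ[ℂ] W} (h : IsUqHom (verma η μ) B φ) :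
    B.E (φ (Finsupp.single 0 1)) = 0 := by
  simpa using (LinearMap.congr_fun h.1 (Finsupp.single 0 1)).symm

theorem IsUqHom.K_highest {φ : (ℕ →₀ ℂ) →ₗ[ℂ] W} (h : IsUqHom (verma η μ) B φ) (c : ℂ) :
    B.K c (φ (Finsupp.single 0 1)) = qpow η (c * μ) • φ (Finsupp.single 0 1) := by
  rw [← LinearMap.comp_apply, ← h.2.2 c, LinearMap.comp_apply, verma_K_single, map_smul,
    Nat.cast_zero, mul_zero, sub_zero]

end VermaLift

section Coordinate

variable {η μ : ℂ} {U : Type*} [AddCommGroup U] [Module ℂ U]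

theorem coordinate_tmul (i : ℕ) (x : ℕ →₀ ℂ) (w : U) : coordinate U i (x ⊗ₜ w) = x i • w := by
  simp [coordinate]

theorem eq_zero_of_coordinate_eq_zero {t : (ℕ →₀ ℂ) ⊗[ℂ] U} (h : ∀ i, coordinate U i t = 0) :
    t = 0 := by
  refine (TensorProduct.finsuppScalarLeft ℂ U ℕ).injective ?_
  rw [map_zero]
  ext i : 1
  rw [TensorProduct.finsuppScalarLeft_apply]
  exact h i

variable (B : UqModule η U)

theorem coordinate_tensor_K (c : ℂ) (i : ℕ) (t : (ℕ →₀ ℂ) ⊗[ℂ] U) :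
    coordinate U i (((verma η μ).tensor B).K c t) =
      qpow η (c * (μ - 2 * i)) • B.K c (coordinate U i t) := by
  refine LinearMap.congr_fun (f := coordinate U i ∘ₗ ((verma η μ).tensor B).K c)
      (g := qpow η (c * (μ - 2 * i)) • B.K c ∘ₗ coordinate U i) ?_ t
  ext j w
  by_cases h : j = i
  · subst h
    simp [UqModule.tensor, coordinate_tmul]
  · simp [UqModule.tensor, coordinate_tmul, h]

theorem coordinate_tensor_E (i : ℕ) (t : (ℕ →₀ ℂ) ⊗[ℂ] U) :
    coordinate U i (((verma η μ).tensor B).E t) =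
      (qnum η (i + 1) * qnum η (μ - i)) • B.K 1 (coordinate U (i + 1) t) +
        B.E (coordinate U i t) := by
  refine LinearMap.congr_fun (f := coordinate U i ∘ₗ ((verma η μ).tensor B).E)
      (g := (qnum η (i + 1) * qnum η (μ - i)) • B.K 1 ∘ₗ coordinate U (i + 1) +
        B.E ∘ₗ coordinate U i) ?_ t
  ext j w
  rcases j with _ | j
  · rcases eq_or_ne 0 i with rfl | h
    · simp [UqModule.tensor, coordinate_tmul]
    · simp [UqModule.tensor, coordinate_tmul, h]
  · have index : μ - ((j + 1 : ℕ) : ℂ) + 1 = μ - j := by push_cast; ring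
    rcases eq_or_ne j i with rfl | h
    · simp [UqModule.tensor, coordinate_tmul, verma_E_single, ← index]
    · rcases eq_or_ne (j + 1) i with rfl | h'
      · simp [UqModule.tensor, coordinate_tmul, verma_E_single]
      · simp [UqModule.tensor, coordinate_tmul, verma_E_single, h, h']

theorem coordinate_apply_eq_zero_of_weight {d : ℕ} {t : (ℕ →₀ ℂ) ⊗[ℂ] (Fin (d + 1) → ℂ)} {lam : ℂ}
    (hη : η ≠ 0) (hK : ∀ c, ((verma η μ).tensor (irrep η d)).K c t = qpow η (c * lam) • t)
    {i : ℕ} {a : Fin (d + 1)} (h : μ - 2 * i + (d - 2 * (a.val : ℂ)) ≠ lam) :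
    coordinate _ i t a = 0 := by
  by_contra hne
  refine h (eq_of_forall_qpow_mul_eq hη fun c => mul_right_cancel₀ hne ?_)
  have weight := congrFun (congrArg (coordinate _ i) (hK c)) a
  rw [coordinate_tensor_K, map_smul] at weight
  simp only [Pi.smul_apply, irrep_K_apply, smul_eq_mul, ← mul_assoc, ← qpow_add] at weight
  rw [mul_add, weight]

end Coordinate

section Intertwiner

variable {η μ : ℂ} {k : ℕ}

theorem qnum_nat_succ_ne_zero (hk : ∀ j : ℕ, 1 ≤ j → j ≤ 2 * k → qpow η (2 * j) ≠ 1) {i : ℕ}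
    (hi : i < k) : qnum η (i + 1) ≠ 0 :=
  qnum_ne_zero (by simpa using hk 1 le_rfl (by lia))
    (by exact_mod_cast hk (i + 1) (by lia) (by lia))

theorem qnum_sub_nat_ne_zero (hk : ∀ j : ℕ, 1 ≤ j → j ≤ 2 * k → qpow η (2 * j) ≠ 1)
    (hμ : ∀ l : ℕ, qpow η (2 * (μ - l)) ≠ 1) {i : ℕ} (hi : i < k) : qnum η (μ - i) ≠ 0 :=
  qnum_ne_zero (by simpa using hk 1 le_rfl (by lia)) (hμ i)

theorem eq_zero_of_isSingular (hk : ∀ j : ℕ, 1 ≤ j → j ≤ 2 * k → qpow η (2 * j) ≠ 1)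
    (hμ : ∀ l : ℕ, qpow η (2 * (μ - l)) ≠ 1) {t : (ℕ →₀ ℂ) ⊗[ℂ] (Fin (2 * k + 1) → ℂ)}
    (hE : ((verma η μ).tensor (irrep η (2 * k))).E t = 0)
    (hK : ∀ c, ((verma η μ).tensor (irrep η (2 * k))).K c t = qpow η (c * μ) • t)
    (h0 : coordinate _ 0 t = 0) : t = 0 := by
  refine eq_zero_of_coordinate_eq_zero fun i => ?_
  induction i with
  | zero => exact h0
  | succ i ih =>
    rcases lt_or_ge i k with hi | hi
    · have recursion := coordinate_tensor_E (μ := μ) (irrep η (2 * k)) i t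
      rw [hE, ih, map_zero, map_zero, add_zero] at recursion
      have K_eq_zero := (smul_eq_zero.1 recursion.symm).resolve_left
        (mul_ne_zero (qnum_nat_succ_ne_zero hk hi) (qnum_sub_nat_ne_zero hk hμ hi))
      rw [← Module.End.one_apply (R := ℂ) (coordinate _ (i + 1) t),
        ← (irrep η (2 * k)).K_neg_mul 1, Module.End.mul_apply, K_eq_zero, map_zero]
    · funext a
      refine coordinate_apply_eq_zero_of_weight (ne_zero_of_qpow_ne_one (hμ 0)) hK fun h => ?_
      have : (k : ℂ) = ((i + 1 + a.val : ℕ) : ℂ) := by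
        push_cast at h ⊢
        linear_combination h / 2
      have := Nat.cast_injective this
      lia

theorem IsIntertwiner.unique (hk : ∀ j : ℕ, 1 ≤ j → j ≤ 2 * k → qpow η (2 * j) ≠ 1)
    (hμ : ∀ l : ℕ, qpow η (2 * (μ - l)) ≠ 1) {u : Fin (2 * k + 1) → ℂ}
    {Φ Φ' : (ℕ →₀ ℂ) →ₗ[ℂ] (ℕ →₀ ℂ) ⊗[ℂ] (Fin (2 * k + 1) → ℂ)}
    (h : IsIntertwiner η μ k u Φ) (h' : IsIntertwiner η μ k u Φ') : Φ = Φ' := by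
  refine h.1.verma_ext h'.1 (sub_eq_zero.1 (eq_zero_of_isSingular hk hμ ?_ (fun c => ?_) ?_))
  · rw [map_sub, h.1.E_highest, h'.1.E_highest, sub_self]
  · rw [map_sub, h.1.K_highest, h'.1.K_highest, smul_sub]
  · rw [map_sub, h.2, h'.2, sub_self]

variable (η μ k) in
/-- The coefficients `c_j` of the singular vector of weight `μ` in `M_μ ⊗ U`; they vanish for
`j > k`. -/
def singularCoeff : ℕ → ℂ
  | 0 => 1
  | j + 1 => -singularCoeff j * (qpow η (-(2 * (j + 1))) * (qnum η (k - j) * qnum η (k + j + 1)) /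
      (qnum η (j + 1) * qnum η (μ - j)))

theorem singularCoeff_eq_zero_of_lt {j : ℕ} (hj : k < j) : singularCoeff η μ k j = 0 := by
  induction j, hj using Nat.le_induction with
  | base => simp [singularCoeff, qnum_zero]
  | succ j _ ih => rw [singularCoeff, ih, neg_zero, zero_mul]

theorem singularCoeff_succ_mul (hk : ∀ j : ℕ, 1 ≤ j → j ≤ 2 * k → qpow η (2 * j) ≠ 1)
    (hμ : ∀ l : ℕ, qpow η (2 * (μ - l)) ≠ 1) {j : ℕ} (hj : j < k) :
    singularCoeff η μ k (j + 1) * (qnum η (j + 1) * qnum η (μ - j)) =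
      -singularCoeff η μ k j *
        (qpow η (-(2 * (j + 1))) * (qnum η (k - j) * qnum η (k + j + 1))) := by
  rw [singularCoeff, mul_assoc, div_mul_cancel₀ _
    (mul_ne_zero (qnum_nat_succ_ne_zero hk hj) (qnum_sub_nat_ne_zero hk hμ hj))]

variable (η μ k) in
/-- The singular vector `∑_j c_j F ^ j v_μ ⊗ w_(k - j)` of weight `μ` in `M_μ ⊗ U`, the image of
`v_μ` under the intertwining operator. -/
def singularVec : (ℕ →₀ ℂ) ⊗[ℂ] (Fin (2 * k + 1) → ℂ) :=
  ∑ j ∈ range (k + 1),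
    singularCoeff η μ k j • (Finsupp.single j 1 ⊗ₜ[ℂ] irrepVec (2 * k) (k - j))

theorem coordinate_singularVec (i : ℕ) :
    coordinate _ i (singularVec η μ k) = singularCoeff η μ k i • irrepVec (2 * k) (k - i) := by
  simp only [singularVec, map_sum, map_smul, coordinate_tmul, Finsupp.single_apply, ite_smul,
    one_smul, zero_smul, smul_ite, smul_zero, sum_ite_eq', mem_range]
  split_ifs with hi
  · rfl
  · rw [singularCoeff_eq_zero_of_lt (by lia), zero_smul]

theorem tensor_E_singularVec (hk : ∀ j : ℕ, 1 ≤ j → j ≤ 2 * k → qpow η (2 * j) ≠ 1)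
    (hμ : ∀ l : ℕ, qpow η (2 * (μ - l)) ≠ 1) :
    ((verma η μ).tensor (irrep η (2 * k))).E (singularVec η μ k) = 0 := by
  refine eq_zero_of_coordinate_eq_zero fun i => ?_
  rw [coordinate_tensor_E, coordinate_singularVec, coordinate_singularVec, map_smul, map_smul]
  rcases lt_or_ge i k with hi | hi
  · obtain ⟨a, rfl⟩ : ∃ a, k = i + 1 + a := Nat.exists_eq_add_of_le hi
    rw [show i + 1 + a - i = a + 1 by lia, Nat.add_sub_cancel_left, irrep_K_irrepVec,
      irrep_E_irrepVec_succ _ (by lia), smul_smul, smul_smul, smul_smul, ← add_smul]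
    convert zero_smul ℂ (irrepVec (2 * (i + 1 + a)) a)
    have recursion := singularCoeff_succ_mul hk hμ hi
    have inverse : qpow η (-(2 * (i + 1))) * qpow η (2 * (i + 1)) = 1 := by
      rw [qpow_neg, inv_mul_cancel₀ (qpow_ne_zero _ _)]
    push_cast at recursion ⊢
    rw [show (i + 1 + a - i : ℂ) = a + 1 by ring] at recursion
    rw [show (1 * (2 * (i + 1 + a) - 2 * a) : ℂ) = 2 * (i + 1) by ring,
      show (2 * (i + 1 + a) - a : ℂ) = i + 1 + a + i + 1 by ring]
    linear_combination qpow η (2 * (i + 1)) * recursion -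
      singularCoeff η μ (i + 1 + a) i * qnum η (a + 1) * qnum η (i + 1 + a + i + 1) * inverse
  · rw [singularCoeff_eq_zero_of_lt (Nat.lt_succ_of_le hi), zero_smul, smul_zero, zero_add,
      Nat.sub_eq_zero_of_le hi, irrep_E_irrepVec_zero, smul_zero]

theorem tensor_K_singularVec (c : ℂ) :
    ((verma η μ).tensor (irrep η (2 * k))).K c (singularVec η μ k) =
      qpow η (c * μ) • singularVec η μ k := by
  refine sub_eq_zero.1 (eq_zero_of_coordinate_eq_zero fun i => ?_)
  rw [map_sub, map_smul, coordinate_tensor_K, coordinate_singularVec, map_smul, irrep_K_irrepVec]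
  rcases le_or_gt i k with hi | hi
  · rw [smul_comm (singularCoeff η μ k i), smul_smul, ← qpow_add, ← mul_add, Nat.cast_sub hi,
      Nat.cast_mul, Nat.cast_two, show μ - 2 * i + (2 * k - 2 * (k - i : ℂ)) = μ by ring, sub_self]
  · simp only [singularCoeff_eq_zero_of_lt hi, zero_smul, smul_zero, sub_zero]

theorem isIntertwiner_vermaLift (hk : ∀ j : ℕ, 1 ≤ j → j ≤ 2 * k → qpow η (2 * j) ≠ 1)
    (hμ : ∀ l : ℕ, qpow η (2 * (μ - l)) ≠ 1) :
    IsIntertwiner η μ k (irrepVec (2 * k) k)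
      (vermaLift ((verma η μ).tensor (irrep η (2 * k))) (singularVec η μ k)) :=
  ⟨isUqHom_vermaLift (tensor_E_singularVec hk hμ) tensor_K_singularVec, by
    rw [vermaLift_single, pow_zero, Module.End.one_apply, coordinate_singularVec, singularCoeff,
      one_smul, Nat.sub_zero]⟩

theorem IsIntertwiner.smul {u : Fin (2 * k + 1) → ℂ}
    {Φ : (ℕ →₀ ℂ) →ₗ[ℂ] (ℕ →₀ ℂ) ⊗[ℂ] (Fin (2 * k + 1) → ℂ)}
    (h : IsIntertwiner η μ k u Φ) (a : ℂ) : IsIntertwiner η μ k (a • u) (a • Φ) := by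
  obtain ⟨⟨hE, hF, hK⟩, h0⟩ := h
  refine ⟨⟨?_, ?_, fun c => ?_⟩, ?_⟩
  · rw [LinearMap.smul_comp, hE, LinearMap.comp_smul]
  · rw [LinearMap.smul_comp, hF, LinearMap.comp_smul]
  · rw [LinearMap.smul_comp, hK, LinearMap.comp_smul]
  · rw [LinearMap.smul_apply, map_smul, h0]

end Intertwiner

section Trace

theorem tensor_F_pow {η : ℂ} {V W : Type*} [AddCommGroup V] [Module ℂ V] [AddCommGroup W]
    [Module ℂ W] (A : UqModule η V) (B : UqModule η W) (n : ℕ) :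
    (A.tensor B).F ^ n = ∑ r ∈ range (n + 1),
      qBinom (qpow η 2) n r • TensorProduct.map (A.F ^ (n - r) * A.K (-1) ^ r) (B.F ^ r) := by
  have q_commute : TensorProduct.map (A.K (-1)) B.F * TensorProduct.map A.F 1 =
      qpow η 2 • (TensorProduct.map A.F 1 * TensorProduct.map (A.K (-1)) B.F) := by
    rw [← TensorProduct.map_mul, ← TensorProduct.map_mul, UqModule.K_mul_F, mul_one, one_mul,
      TensorProduct.map_smul_left, mul_neg_one, neg_neg]
  refine (add_pow_of_q_commute q_commute n).trans (sum_congr rfl fun r _ => ?_)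
  rw [TensorProduct.map_pow, TensorProduct.map_pow, one_pow, ← TensorProduct.map_mul, one_mul]

variable {η μ : ℂ} {k : ℕ}

theorem coordinate_tensor_F_pow_tmul (η μ : ℂ) (i j d a : ℕ) :
    coordinate _ i ((((verma η μ).tensor (irrep η d)).F ^ i)
        (Finsupp.single j 1 ⊗ₜ[ℂ] irrepVec d a)) =
      (qBinom (qpow η 2) i j * qpow η (-(j * (μ - 2 * j)))) • irrepVec d (a + j) := by
  have term (r) (hr : r ∈ range (i + 1)) : coordinate _ i ((qBinom (qpow η 2) i r •
      TensorProduct.map ((verma η μ).F ^ (i - r) * (verma η μ).K (-1) ^ r) ((irrep η d).F ^ r))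
        (Finsupp.single j 1 ⊗ₜ[ℂ] irrepVec d a)) = if r = j then
      (qBinom (qpow η 2) i j * qpow η (-(j * (μ - 2 * j)))) • irrepVec d (a + j) else 0 := by
    have index : j + (i - r) = i ↔ r = j := by have := mem_range_succ_iff.1 hr; lia
    rw [LinearMap.smul_apply, TensorProduct.map_tmul, Module.End.mul_apply, verma_K_pow_single,
      map_smul ((verma η μ).F ^ (i - r)), verma_F_pow_single, irrep_F_pow_irrepVec, map_smul,
      coordinate_tmul, Finsupp.smul_apply, Finsupp.single_apply]
    simp only [index]
    split_ifs with h
    · rw [h, smul_smul, smul_eq_mul, mul_one, neg_one_mul, mul_neg]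
    · rw [smul_zero, zero_smul, smul_zero]
  rw [tensor_F_pow, LinearMap.sum_apply, map_sum, sum_congr rfl term, sum_ite_eq']
  split_ifs with hj
  · rfl
  · rw [qBinom_eq_zero_of_lt _ (by simpa using hj), zero_mul, zero_smul]

variable (η μ k) in
/-- The numbers `c_j q ^ (-j (μ - 2 j))`, where `c_j` are the coefficients of the singular vector:
the coefficients of the Gaussian binomials in the diagonal entries of the intertwining operator. -/
def traceCoeff (j : ℕ) : ℂ := singularCoeff η μ k j * qpow η (-(j * (μ - 2 * j)))

theorem coordinate_vermaLift_singularVec (i : ℕ) :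
    coordinate _ i (vermaLift ((verma η μ).tensor (irrep η (2 * k))) (singularVec η μ k)
      (Finsupp.single i 1)) =
    (∑ j ∈ range (k + 1), traceCoeff η μ k j * qBinom (qpow η 2) i j) • irrepVec (2 * k) k := by
  rw [vermaLift_single, singularVec, map_sum, map_sum, sum_smul]
  refine sum_congr rfl fun j hj => ?_
  rw [map_smul, map_smul, coordinate_tensor_F_pow_tmul, smul_smul,
    Nat.sub_add_cancel (mem_range_succ_iff.1 hj), traceCoeff, mul_left_comm,
    mul_comm (qBinom _ _ _)]

theorem eq_smul_irrepVec_of_K_eq (hk : ∀ j : ℕ, 1 ≤ j → j ≤ 2 * k → qpow η (2 * j) ≠ 1)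
    {u : Fin (2 * k + 1) → ℂ} (hu : (irrep η (2 * k)).K 1 u = u) :
    u = u ⟨k, by lia⟩ • irrepVec (2 * k) k := by
  funext a
  rcases lt_trichotomy a.val k with h | h | h
  · suffices u a = 0 by simp [irrepVec, h.ne, this]
    by_contra hne
    have weight := (mul_eq_right₀ hne).1 ((irrep_K_apply η 1 _ u a).symm.trans (congrFun hu a))
    refine hk (k - a.val) (by lia) (by lia) (Eq.trans ?_ weight)
    rw [Nat.cast_sub h.le]; push_cast; ring_nf
  · simp only [Pi.smul_apply, irrepVec, if_pos h, smul_eq_mul, mul_one]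
    exact congrArg u (Fin.ext h)
  · suffices u a = 0 by simp [irrepVec, h.ne', this]
    by_contra hne
    have weight := (mul_eq_right₀ hne).1 ((irrep_K_apply η 1 _ u a).symm.trans (congrFun hu a))
    refine qpow_neg_ne_one (hk (a.val - k) (by lia) (by lia)) (Eq.trans ?_ weight)
    rw [Nat.cast_sub h.le]; push_cast; ring_nf

variable (η μ k) in
/-- The trace function `ψ (ν, μ)`, summed in closed form over the basis of the Verma module. -/
def traceValue (ν : ℂ) : ℂ :=
  qpow η (ν * μ) * ∑ j ∈ range (k + 1), traceCoeff η μ k j *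
    (qpow η (-(2 * ν)) ^ j * (∏ l ∈ range (j + 1), (1 - qpow η 2 ^ l * qpow η (-(2 * ν))))⁻¹)

theorem hasSum_traceValue {ν : ℂ} (hq : ‖qpow η 2‖ ≤ 1) (hν : ‖qpow η (-(2 * ν))‖ < 1) :
    HasSum (fun i : ℕ => qpow η (ν * (μ - 2 * i)) *
      ∑ j ∈ range (k + 1), traceCoeff η μ k j * qBinom (qpow η 2) i j) (traceValue η μ k ν) := by
  refine ((hasSum_sum fun j (_ : j ∈ range (k + 1)) =>
    (hasSum_qBinom_mul_pow hq hν j).mul_left (traceCoeff η μ k j)).mul_left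
      (qpow η (ν * μ))).congr_fun fun i => ?_
  rw [show ν * (μ - 2 * i) = ν * μ + i * -(2 * ν) by ring, qpow_add, qpow_nat_mul, mul_assoc,
    mul_sum]
  exact congrArg _ (sum_congr rfl fun j _ => by ring)

theorem hasTrace_traceValue {ν : ℂ} (hk : ∀ j : ℕ, 1 ≤ j → j ≤ 2 * k → qpow η (2 * j) ≠ 1)
    (hμ : ∀ l : ℕ, qpow η (2 * (μ - l)) ≠ 1) (hq : ‖qpow η 2‖ ≤ 1) (hν : ‖qpow η (-(2 * ν))‖ < 1) :
    HasTrace η ν μ k (traceValue η μ k ν) := by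
  intro u hu
  have u_eq := eq_smul_irrepVec_of_K_eq hk hu
  refine ⟨_, u_eq.symm ▸ (isIntertwiner_vermaLift hk hμ).smul (u ⟨k, by lia⟩),
    ((hasSum_traceValue hq hν).smul_const u).congr_fun fun i => ?_⟩
  rw [verma_K_single, map_smul, map_smul, LinearMap.smul_apply, map_smul,
    coordinate_vermaLift_singularVec, smul_comm (u ⟨k, by lia⟩), ← u_eq, smul_smul]

theorem HasTrace.unique {ν : ℂ} (hk : ∀ j : ℕ, 1 ≤ j → j ≤ 2 * k → qpow η (2 * j) ≠ 1)
    (hμ : ∀ l : ℕ, qpow η (2 * (μ - l)) ≠ 1) {ψ ψ' : ℂ}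
    (h : HasTrace η ν μ k ψ) (h' : HasTrace η ν μ k ψ') : ψ = ψ' := by
  obtain ⟨Φ, hΦ, hψ⟩ := h _ (irrep_K_irrepVec_middle η 1 k)
  obtain ⟨Φ', hΦ', hψ'⟩ := h' _ (irrep_K_irrepVec_middle η 1 k)
  obtain rfl := hΦ.unique hk hμ hΦ'
  simpa [irrepVec] using congrFun (hψ.unique hψ') ⟨k, by lia⟩

end Trace

section ExplicitTrace

/-! ### Partial fractions of the trace function -/

theorem prod_Icc_one_eq_prod_range {M : Type*} [CommMonoid M] (f : ℕ → M) (k : ℕ) :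
    ∏ j ∈ Icc 1 k, f j = ∏ l ∈ range k, f (l + 1) := by
  simp only [← Ico_add_one_right_eq_Icc, prod_Ico_eq_prod_range, Nat.add_sub_cancel, add_comm 1]

theorem differentiable_qpow (η : ℂ) {f : ℂ → ℂ} (hf : Differentiable ℂ f) :
    Differentiable ℂ fun x => qpow η (f x) := by
  unfold qpow; fun_prop

theorem norm_qpow_two_mul_int {η : ℂ} (hη : η.re = 0) (n : ℤ) : ‖qpow η (2 * n)‖ = 1 := by
  rw [qpow, Complex.norm_exp]; simp [hη]

theorem differentiable_coeff_mul {f g : ℂ → Polynomial ℂ}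
    (hf : ∀ s, Differentiable ℂ fun x => (f x).coeff s)
    (hg : ∀ s, Differentiable ℂ fun x => (g x).coeff s) (s : ℕ) :
    Differentiable ℂ fun x => (f x * g x).coeff s := by
  simp only [Polynomial.coeff_mul]
  exact Differentiable.fun_sum fun i _ => (hf i.1).mul (hg i.2)

variable (η : ℂ) (k : ℕ) (μ ν : ℂ)

/-- The polynomial whose coefficients are, up to a common factor, the coefficients of the partial
fraction expansion of the renormalized trace function. -/
def tracePoly : Polynomial ℂ :=
  ∏ l ∈ range k, ((Polynomial.X - Polynomial.C (qpow η (-2) ^ (l + 1))) *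
    (1 - Polynomial.C (qpow η (-(2 * (μ - l)))) * Polynomial.X))

/-- The partial fraction expansion in `q ^ (-2 ν)` of the renormalized trace function. -/
def explicitTrace : ℂ :=
  qpow η ((ν + k) * (μ - k)) / (∏ l ∈ range k, (1 - qpow η (-2) ^ (l + 1))) *
    ∑ s ∈ range (2 * k + 1), (tracePoly η k μ).coeff s * (1 - qpow η (2 * (s - k - ν)))⁻¹

theorem natDegree_tracePoly_le : (tracePoly η k μ).natDegree ≤ 2 * k := by
  refine (Polynomial.natDegree_prod_le _ _).trans
    ((sum_le_card_nsmul _ _ 2 fun l _ => ?_).trans_eq (by rw [card_range, smul_eq_mul, mul_comm]))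
  compute_degree

theorem sum_tracePoly_coeff_mul_pow_eq_prod (x : ℂ) :
    ∑ s ∈ range (2 * k + 1), (tracePoly η k μ).coeff s * x ^ s =
      ∏ l ∈ range k, ((x - qpow η (-2) ^ (l + 1)) * (1 - qpow η (-(2 * (μ - l))) * x)) := by
  rw [← Polynomial.eval_eq_sum_range' (Nat.lt_succ_of_le (natDegree_tracePoly_le η k μ))]
  simp [tracePoly, Polynomial.eval_prod]

theorem qpow_neg_two_mul_sub_nat (l : ℕ) :
    qpow η (-(2 * (μ - l))) = qpow η (-(2 * μ)) * qpow η (-2) ^ (-l : ℤ) := by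
  rw [← qpow_int_mul, ← qpow_add]; congr 1; push_cast; ring

theorem sum_tracePoly_coeff_mul_qpow_pow (m : ℕ) :
    ∑ s ∈ range (2 * k + 1), (tracePoly η k μ).coeff s * qpow η (2 * (s - k - ν)) ^ m =
      (∏ l ∈ range k, ((1 - qpow η (-2) ^ (l + 1 + m)) *
        (1 - qpow η (-(2 * μ)) * qpow η (-2) ^ (-(l + m) : ℤ)))) * qpow η (-(2 * ν)) ^ m := by
  have hp : qpow η (-2) ≠ 0 := qpow_ne_zero _ _
  have term (s : ℕ) : (tracePoly η k μ).coeff s * qpow η (2 * (s - k - ν)) ^ m =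
      (tracePoly η k μ).coeff s * (qpow η (-2) ^ (-m : ℤ)) ^ s *
        ((qpow η (-2) ^ m) ^ k * qpow η (-(2 * ν)) ^ m) := by
    rw [mul_assoc, ← zpow_natCast _ s, ← zpow_mul, ← qpow_int_mul, ← pow_mul, ← qpow_nat_mul,
      ← qpow_nat_mul, ← qpow_nat_mul, ← qpow_add, ← qpow_add]
    congr 2; push_cast; ring
  have factor (l : ℕ) : (qpow η (-2) ^ (-m : ℤ) - qpow η (-2) ^ (l + 1)) * qpow η (-2) ^ m =
      1 - qpow η (-2) ^ (l + 1 + m) := by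
    rw [sub_mul, zpow_neg, zpow_natCast, inv_mul_cancel₀ (pow_ne_zero _ hp), ← pow_add]
  rw [sum_congr rfl fun s _ => term s, ← sum_mul, sum_tracePoly_coeff_mul_pow_eq_prod, ← mul_assoc]
  congr 1
  rw [show (qpow η (-2) ^ m) ^ k = ∏ _l ∈ range k, qpow η (-2) ^ m by rw [prod_const, card_range],
    ← prod_mul_distrib]
  refine prod_congr rfl fun l _ => ?_
  rw [mul_right_comm, factor, qpow_neg_two_mul_sub_nat, mul_assoc, ← zpow_add₀ hp, neg_add]

theorem differentiable_tracePoly_coeff (s : ℕ) :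
    Differentiable ℂ fun μ => (tracePoly η k μ).coeff s := by
  induction k generalizing s with
  | zero => simp [tracePoly]
  | succ k ih =>
    simp only [tracePoly, prod_range_succ]
    refine differentiable_coeff_mul ih
      (differentiable_coeff_mul (fun s => differentiable_const _) fun s => ?_) s
    simp only [Polynomial.coeff_sub, Polynomial.coeff_C_mul]
    exact (differentiable_const _).sub ((differentiable_qpow η (by fun_prop)).mul_const _)

theorem one_sub_qpow_ne_zero {η ν : ℂ} {k : ℕ} (hν : ν ∈ regularDomain η k) {s : ℕ}
    (hs : s ∈ range (2 * k + 1)) : 1 - qpow η (2 * (s - k - ν)) ≠ 0 := by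
  have hs := mem_range.1 hs
  refine sub_ne_zero.2 (Ne.symm ?_)
  convert qpow_neg_ne_one (hν ((s : ℤ) - k) (by rw [abs_le]; lia)) using 2
  push_cast; ring

theorem differentiableOn_explicitTrace :
    DifferentiableOn ℂ (fun ν => explicitTrace η k μ ν) (regularDomain η k) := by
  refine DifferentiableOn.mul ?_ (DifferentiableOn.fun_sum fun s hs => ?_)
  · exact ((differentiable_qpow η (by fun_prop)).div_const _).differentiableOn
  · refine (differentiableOn_const _).mul (DifferentiableOn.inv ?_ fun ν hν =>
      one_sub_qpow_ne_zero hν hs)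
    exact ((differentiable_const _).sub (differentiable_qpow η (by fun_prop))).differentiableOn

theorem differentiable_explicitTrace : Differentiable ℂ fun μ => explicitTrace η k μ ν :=
  Differentiable.mul ((differentiable_qpow η (by fun_prop)).div_const _)
    (Differentiable.fun_sum fun s _ => (differentiable_tracePoly_coeff η k s).mul_const _)

variable {η k μ ν}

theorem hasSum_explicitTrace (hη : η.re = 0) (hν : ‖qpow η (-(2 * ν))‖ < 1) :
    HasSum (fun m : ℕ => qpow η ((ν + k) * (μ - k)) /
      (∏ l ∈ range k, (1 - qpow η (-2) ^ (l + 1))) *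
      ((∏ l ∈ range k, ((1 - qpow η (-2) ^ (l + 1 + m)) *
        (1 - qpow η (-(2 * μ)) * qpow η (-2) ^ (-(l + m) : ℤ)))) * qpow η (-(2 * ν)) ^ m))
      (explicitTrace η k μ ν) := by
  have geometric (s : ℕ) : HasSum (fun m : ℕ => qpow η (2 * (s - k - ν)) ^ m)
      (1 - qpow η (2 * (s - k - ν)))⁻¹ := by
    refine hasSum_geometric_of_norm_lt_one ?_
    rwa [show 2 * (s - k - ν) = 2 * ((s - k : ℤ) : ℂ) + -(2 * ν) by push_cast; ring, qpow_add,
      norm_mul, norm_qpow_two_mul_int hη, one_mul]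
  refine ((hasSum_sum fun s (_ : s ∈ range (2 * k + 1)) =>
    (geometric s).mul_left ((tracePoly η k μ).coeff s)).mul_left _).congr_fun fun m => ?_
  rw [sum_tracePoly_coeff_mul_qpow_pow]

theorem one_sub_qpow_pow_ne_zero {j : ℕ} (h : qpow η (2 * j) ≠ 1) : 1 - qpow η (-2) ^ j ≠ 0 := by
  rw [← qpow_nat_mul, show (j * -2 : ℂ) = -(2 * j) by ring]
  exact sub_ne_zero.2 (qpow_neg_ne_one h).symm

theorem qnum_eq_mul_one_sub (η x : ℂ) :
    qnum η x = qpow η x * (1 - qpow η (-(2 * x))) / (qpow η 1 - qpow η (-1)) := by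
  rw [qnum, qpow_sub_qpow_neg]

theorem traceCoeff_succ (hk : ∀ j : ℕ, 1 ≤ j → j ≤ 2 * k → qpow η (2 * j) ≠ 1)
    (hμ : ∀ l : ℕ, qpow η (2 * (μ - l)) ≠ 1) {j : ℕ} (hj : j < k) :
    traceCoeff η μ k (j + 1) * (1 - qpow η (-2) ^ (j + 1)) *
        (1 - qpow η (-(2 * μ)) * qpow η (-2) ^ (-j : ℤ)) =
      -(qpow η (-(2 * μ)) * qpow η (-2) ^ (-(k + j : ℤ))) * (1 - qpow η (-2) ^ (k - j)) *
        (1 - qpow η (-2) ^ (k + j + 1)) * traceCoeff η μ k j := by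
  have hδ : qpow η 1 - qpow η (-1) ≠ 0 :=
    qpow_sub_qpow_neg_ne_zero (by simpa using hk 1 le_rfl (by lia))
  have neg_two_pow (i : ℕ) : qpow η (-2) ^ i = qpow η (-(2 * i)) := by
    rw [← qpow_nat_mul, mul_neg, mul_comm]
  have exponents : qpow η (-(2 * (j + 1))) * (qpow η (k - j) * qpow η (k + j + 1)) *
      qpow η (-((j + 1 : ℕ) * (μ - 2 * (j + 1 : ℕ)))) =
      qpow η (-(2 * μ)) * qpow η (-2) ^ (-(k + j : ℤ)) * qpow η (-(j * (μ - 2 * j))) *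
        (qpow η (j + 1) * qpow η (μ - j)) := by
    simp only [← qpow_int_mul, ← qpow_add]
    congr 1; push_cast; ring
  have recursion := singularCoeff_succ_mul hk hμ hj
  simp only [qnum_eq_mul_one_sub] at recursion
  field_simp at recursion
  rw [mul_comm ((j : ℂ) + 1) 2] at recursion
  rw [← qpow_neg_two_mul_sub_nat, neg_two_pow, neg_two_pow, neg_two_pow, traceCoeff, traceCoeff]
  push_cast [Nat.cast_sub hj.le] at exponents ⊢
  refine mul_right_cancel₀ (mul_ne_zero (qpow_ne_zero η (j + 1)) (qpow_ne_zero η (μ - j))) ?_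
  linear_combination qpow η (-((j + 1) * (μ - 2 * (j + 1)))) * recursion -
    singularCoeff η μ k j * (1 - qpow η (-(2 * (k - j)))) * (1 - qpow η (-(2 * (k + j + 1)))) *
      exponents

theorem prod_qpow_sub_div_qpow_sub (η μ ν : ℂ) (k : ℕ) :
    ∏ j ∈ Icc 1 k, (qpow η (μ + 1 - j) - qpow η (-μ - 1 + j)) /
        (qpow η (ν + j) - qpow η (-ν - j)) =
      qpow η (k * (μ - ν - k)) *
        ((∏ l ∈ range k, (1 - qpow η (-(2 * μ)) * qpow η (-2) ^ (-l : ℤ))) *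
          (∏ l ∈ range k, (1 - qpow η (-2) ^ (l + 1) * qpow η (-(2 * ν))))⁻¹) := by
  rw [prod_Icc_one_eq_prod_range]
  induction k with
  | zero => simp [qpow_zero]
  | succ k ih =>
    have numerator : qpow η (μ + 1 - (k + 1 : ℕ)) - qpow η (-μ - 1 + (k + 1 : ℕ)) =
        qpow η (μ - k) * (1 - qpow η (-(2 * μ)) * qpow η (-2) ^ (-k : ℤ)) := by
      rw [← qpow_neg_two_mul_sub_nat, ← qpow_sub_qpow_neg]; push_cast; ring_nf
    have denominator : qpow η (ν + (k + 1 : ℕ)) - qpow η (-ν - (k + 1 : ℕ)) =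
        qpow η (ν + (k + 1)) * (1 - qpow η (-2) ^ (k + 1) * qpow η (-(2 * ν))) := by
      rw [← qpow_nat_mul, ← qpow_add, show ((k + 1 : ℕ) * -2 + -(2 * ν) : ℂ) =
        -(2 * (ν + (k + 1))) by push_cast; ring, ← qpow_sub_qpow_neg]; push_cast; ring_nf
    have exponent : qpow η ((k + 1 : ℕ) * (μ - ν - (k + 1 : ℕ))) =
        qpow η (k * (μ - ν - k)) * (qpow η (μ - k) * (qpow η (ν + (k + 1)))⁻¹) := by
      rw [← qpow_neg, ← qpow_add, ← qpow_add]; congr 1; push_cast; ring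
    simp only [prod_range_succ, ih, numerator, denominator, exponent, mul_inv]
    rw [mul_div_mul_comm, div_eq_mul_inv, div_eq_mul_inv]
    ring

theorem explicitTrace_eq (hη : η.re = 0)
    (hk : ∀ j : ℕ, 1 ≤ j → j ≤ 2 * k → qpow η (2 * j) ≠ 1)
    (hμ : ∀ l : ℕ, qpow η (2 * (μ - l)) ≠ 1) (hν : ‖qpow η (-(2 * ν))‖ < 1) :
    explicitTrace η k μ ν =
      (∏ j ∈ Icc 1 k, (qpow η (μ + 1 - j) - qpow η (-μ - 1 + j)) /
        (qpow η (ν + j) - qpow η (-ν - j))) * traceValue η μ k ν := by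
  have hp : ‖qpow η (-2)‖ = 1 := by simpa using norm_qpow_two_mul_int hη (-1)
  have prod_ne_zero : ∏ l ∈ range k, (1 - qpow η (-2) ^ (l + 1)) ≠ 0 :=
    prod_ne_zero_iff.2 fun l hl => one_sub_qpow_pow_ne_zero
      (hk _ (by lia) (by have := mem_range.1 hl; lia))
  have coefficient := sum_trace_term (M := qpow η (-(2 * μ))) (d := traceCoeff η μ k)
    (qpow_ne_zero η (-2)) (by simp [traceCoeff, singularCoeff, qpow_zero])
    (fun j hj => one_sub_qpow_pow_ne_zero (hk _ (by lia) (by lia)))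
    (fun j _ => by
      rw [← qpow_neg_two_mul_sub_nat]
      exact sub_ne_zero.2 (qpow_neg_ne_one (hμ j)).symm)
    (fun j hj => traceCoeff_succ hk hμ hj)
  have series := ((hasSum_sum fun j (_ : j ∈ range (k + 1)) =>
    (hasSum_zpow_mul_qBinom_mul_pow hp hν j k).mul_left (traceCoeff η μ k j)).mul_left
      (qpow η ((ν + k) * (μ - k)) *
        ∏ l ∈ range k, (1 - qpow η (-(2 * μ)) * qpow η (-2) ^ (-l : ℤ))))
  refine ((hasSum_explicitTrace hη hν).congr_fun fun m => ?_).unique series |>.trans ?_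
  · rw [← coefficient m, mul_assoc (∏ l ∈ range k, _), div_mul_eq_mul_div, mul_left_comm,
      mul_div_cancel_left₀ _ prod_ne_zero, mul_assoc, mul_assoc, sum_mul]
    simp only [mul_assoc]
  · rw [prod_qpow_sub_div_qpow_sub, traceValue, ← qpow_neg η (-2), neg_neg,
      show (ν + k) * (μ - k) = ν * μ + k * (μ - ν - k) by ring, qpow_add]
    simp only [← mul_assoc, ← sum_mul]
    ring

theorem isRenormalizedTrace_explicitTrace (hη : η.re = 0)
    (hk : ∀ j : ℕ, 1 ≤ j → j ≤ 2 * k → qpow η (2 * j) ≠ 1) :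
    IsRenormalizedTrace η k fun ν μ => explicitTrace η k μ ν where
  eq_trace μ ν hμ hν := ⟨_,
    hasTrace_traceValue hk hμ (by simpa using (norm_qpow_two_mul_int hη 1).le) hν,
    explicitTrace_eq hη hk hμ hν⟩
  holomorphic_left μ := differentiableOn_explicitTrace η k μ
  holomorphic_right ν _ := differentiable_explicitTrace η k ν

end ExplicitTrace

section Uniqueness

/-! ### Uniqueness of the analytic continuation -/

variable {η ν : ℂ} {k : ℕ}

theorem countable_setOf_qpow_eq_one (hη : η ≠ 0) :
    {x : ℂ | ∃ l : ℤ, qpow η (2 * (x - l)) = 1}.Countable := by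
  refine (Set.countable_range fun x : ℤ × ℤ =>
    (x.1 : ℂ) + x.2 * (2 * Real.pi * Complex.I) / (2 * η)).mono ?_
  rintro x ⟨l, hl⟩
  obtain ⟨n, hn⟩ := Complex.exp_eq_one_iff.1 hl
  refine ⟨(l, n), ?_⟩
  dsimp only
  rw [← hn]
  field_simp
  ring

theorem isOpen_regularDomain (η : ℂ) (k : ℕ) : IsOpen (regularDomain η k) := by
  have eq_biInter : regularDomain η k =
      ⋂ l ∈ Set.Icc (-(k : ℤ)) k, {ν : ℂ | qpow η (2 * (ν - l)) ≠ 1} := by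
    ext ν
    simp only [regularDomain, Set.mem_ofPred_eq, Set.mem_iInter, Set.mem_Icc, abs_le]
  rw [eq_biInter]
  exact (Set.finite_Icc _ _).isOpen_biInter fun l _ =>
    isOpen_ne_fun (differentiable_qpow η (by fun_prop)).continuous continuous_const

theorem isPreconnected_regularDomain (hη : η ≠ 0) (k : ℕ) :
    IsPreconnected (regularDomain η k) := by
  have countable_compl : (regularDomain η k)ᶜ.Countable := by
    refine (countable_setOf_qpow_eq_one hη).mono fun ν hν => ?_
    simp only [regularDomain, Set.mem_compl_iff, Set.mem_ofPred_eq, not_forall, not_not] at hν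
    obtain ⟨l, _, hl⟩ := hν
    exact ⟨l, hl⟩
  rw [← compl_compl (regularDomain η k)]
  refine (countable_compl.isPathConnected_compl_of_one_lt_rank ?_).isConnected.isPreconnected
  rw [Complex.rank_real_complex]
  exact_mod_cast one_lt_two

theorem ne_zero_of_mem_regularDomain (hν : ν ∈ regularDomain η k) : η ≠ 0 :=
  ne_zero_of_qpow_ne_one (hν 0 (by simp))

theorem mem_regularDomain_of_norm_lt_one (hη : η.re = 0) (hν : ‖qpow η (-(2 * ν))‖ < 1) :
    ν ∈ regularDomain η k := by
  intro l _ h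
  have norm_eq_one := congrArg norm h
  rw [show 2 * (ν - l) = -(-(2 * ν)) + 2 * ((-l : ℤ) : ℂ) by push_cast; ring, qpow_add, norm_mul,
    norm_qpow_two_mul_int hη, qpow_neg, norm_inv, norm_one, mul_one, inv_eq_one] at norm_eq_one
  exact hν.ne norm_eq_one

variable {Ψ Ψ' : ℂ → ℂ → ℂ}

theorem IsRenormalizedTrace.eq_of_generic (hη : η.re = 0)
    (hk : ∀ j : ℕ, 1 ≤ j → j ≤ 2 * k → qpow η (2 * j) ≠ 1) (h : IsRenormalizedTrace η k Ψ)
    (h' : IsRenormalizedTrace η k Ψ') (hν : ν ∈ regularDomain η k) {μ : ℂ}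
    (hμ : ∀ l : ℕ, qpow η (2 * (μ - l)) ≠ 1) : Ψ ν μ = Ψ' ν μ := by
  have hη0 := ne_zero_of_mem_regularDomain hν
  have convergent : ‖qpow η (-(2 * η⁻¹))‖ < 1 := by
    rw [qpow, show η * -(2 * η⁻¹) = -2 by field_simp, Complex.norm_exp]
    simp
  have continuous_norm : Continuous fun ν : ℂ => ‖qpow η (-(2 * ν))‖ :=
    (differentiable_qpow η (by fun_prop)).continuous.norm
  refine ((h.holomorphic_left μ).analyticOnNhd
    (isOpen_regularDomain η k)).eqOn_of_preconnected_of_eventuallyEq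
      ((h'.holomorphic_left μ).analyticOnNhd (isOpen_regularDomain η k))
      (isPreconnected_regularDomain hη0 k) (mem_regularDomain_of_norm_lt_one hη convergent) ?_ hν
  filter_upwards [continuous_norm.continuousAt.eventually_lt_const convergent] with x hx
  obtain ⟨ψ, hψ, eq_ψ⟩ := h.eq_trace μ x hμ hx
  obtain ⟨ψ', hψ', eq_ψ'⟩ := h'.eq_trace μ x hμ hx
  rw [eq_ψ, eq_ψ', hψ.unique hk hμ hψ']

theorem IsRenormalizedTrace.unique (hη : η.re = 0)
    (hk : ∀ j : ℕ, 1 ≤ j → j ≤ 2 * k → qpow η (2 * j) ≠ 1) (h : IsRenormalizedTrace η k Ψ)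
    (h' : IsRenormalizedTrace η k Ψ') (hν : ν ∈ regularDomain η k) : Ψ ν = Ψ' ν :=
  Continuous.ext_on
    ((countable_setOf_qpow_eq_one (ne_zero_of_mem_regularDomain hν)).dense_compl ℂ)
    (h.holomorphic_right ν hν).continuous (h'.holomorphic_right ν hν).continuous
    fun _ hμ => h.eq_of_generic hη hk h' hν fun l hl => hμ ⟨l, by simpa using hl⟩

theorem renormalizedTrace_eq (hη : η.re = 0)
    (hk : ∀ j : ℕ, 1 ≤ j → j ≤ 2 * k → qpow η (2 * j) ≠ 1)
    (hν : ν ∈ regularDomain η k) (μ : ℂ) : renormalizedTrace η k ν μ = explicitTrace η k μ ν :=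
  have continuation := isRenormalizedTrace_explicitTrace hη hk
  congrFun (IsRenormalizedTrace.unique hη hk (Classical.epsilon_spec ⟨_, continuation⟩)
    continuation hν) μ

end Uniqueness

section RogersNum

/-! ### Rogers polynomials -/

variable {R S : Type*} [CommRing R] [CommRing S]

/-- The numerator `∏_{l=1}^k (1 - Q ^ (a + l)) (1 - Q ^ (b + l))` of the coefficient of
`T ^ (b - a)` in the Rogers polynomial of degree `a + b`. -/
def rogersNum (Q : R) (k a b : ℕ) : R :=
  ∏ l ∈ range k, ((1 - Q ^ (a + l + 1)) * (1 - Q ^ (b + l + 1)))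

theorem map_rogersNum (f : R →+* S) (Q : R) (k a b : ℕ) :
    f (rogersNum Q k a b) = rogersNum (f Q) k a b := by
  simp [rogersNum]

theorem rogersNum_comm (Q : R) (k a b : ℕ) : rogersNum Q k a b = rogersNum Q k b a :=
  prod_congr rfl fun _ _ => mul_comm _ _

theorem rogersNum_zero_left (Q : R) (k N : ℕ) : rogersNum Q k 0 N =
    (∏ l ∈ range k, (1 - Q ^ (l + 1))) * ∏ l ∈ range k, (1 - Q ^ (N + l + 1)) := by
  simp only [rogersNum, zero_add, prod_mul_distrib]

end RogersNum

section Rogers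

open LaurentPolynomial (C T invert)

variable {R : Type*} [Field R] {q Q : R}

theorem rogersNum_zero_ne_zero (hQ : ∀ j : ℕ, 0 < j → Q ^ j ≠ 1) (k N : ℕ) :
    rogersNum Q k 0 N ≠ 0 :=
  prod_ne_zero_iff.2 fun _ _ => mul_ne_zero
    (sub_ne_zero.2 (hQ _ (by lia)).symm) (sub_ne_zero.2 (hQ _ (by lia)).symm)

/-- The monic continuous `q`-ultraspherical polynomial of Rogers of degree `N`, in base `q ^ 2` and
with parameter `q ^ (2 (k + 1))`, as a Laurent polynomial in `T = q ^ x`. -/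
def rogers (q : R) (k N : ℕ) : R[T;T⁻¹] :=
  ∑ j ∈ range (N + 1),
    C (rogersNum (q ^ 2) k j (N - j) / rogersNum (q ^ 2) k 0 N) * T ((N : ℤ) - 2 * j)

theorem coeff_rogers (q : R) (k N : ℕ) (i : ℤ) : (rogers q k N).coeff i =
    ∑ j ∈ range (N + 1), if (N : ℤ) - 2 * j = i then
      rogersNum (q ^ 2) k j (N - j) / rogersNum (q ^ 2) k 0 N else 0 := by
  simp only [rogers, AddMonoidAlgebra.coeff_sum, Finset.sum_apply',
    ← LaurentPolynomial.single_eq_C_mul_T, AddMonoidAlgebra.coeff_single, Finsupp.single_apply]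

theorem coeff_rogers_sub (q : R) (k : ℕ) {N j : ℕ} (hj : j ≤ N) :
    (rogers q k N).coeff ((N : ℤ) - 2 * j) =
      rogersNum (q ^ 2) k j (N - j) / rogersNum (q ^ 2) k 0 N := by
  rw [coeff_rogers, sum_eq_single_of_mem j (mem_range_succ_iff.2 hj), if_pos rfl]
  exact fun i _ hi => if_neg (by lia)

theorem coeff_rogers_eq_zero (q : R) (k : ℕ) {N : ℕ} {i : ℤ}
    (h : ∀ j : ℕ, j ≤ N → (N : ℤ) - 2 * j ≠ i) : (rogers q k N).coeff i = 0 := by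
  rw [coeff_rogers]
  exact sum_eq_zero fun j hj => if_neg (h j (mem_range_succ_iff.1 hj))

theorem coeff_rogers_eq_zero_of_lt_abs (q : R) (k : ℕ) {N : ℕ} {i : ℤ} (h : N < |i|) :
    (rogers q k N).coeff i = 0 :=
  coeff_rogers_eq_zero _ _ fun j hj hji => by rw [← hji, lt_abs] at h; lia

theorem invert_rogers (q : R) (k N : ℕ) : invert (rogers q k N) = rogers q k N := by
  rw [rogers, map_sum, ← sum_range_reflect]
  refine sum_congr rfl fun j hj => ?_
  have hj : j ≤ N := mem_range_succ_iff.1 hj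
  rw [map_mul, LaurentPolynomial.invert_C, LaurentPolynomial.invert_T,
    show N + 1 - 1 - j = N - j by lia, show N - (N - j) = j by lia, rogersNum_comm _ _ (N - j)]
  congr 2
  lia

theorem rogers_zero (hQ : ∀ j : ℕ, 0 < j → (q ^ 2) ^ j ≠ 1) (k : ℕ) : rogers q k 0 = 1 := by
  simp [rogers, div_self (rogersNum_zero_ne_zero hQ k 0)]

theorem coeff_rogers_self (hQ : ∀ j : ℕ, 0 < j → (q ^ 2) ^ j ≠ 1) (k N : ℕ) :
    (rogers q k N).coeff N = 1 := by
  simpa [div_self (rogersNum_zero_ne_zero hQ k N)] using coeff_rogers_sub q k (Nat.zero_le N)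

theorem coeff_neg_of_invert {f : R[T;T⁻¹]} (h : invert f = f) (i : ℤ) :
    f.coeff (-i) = f.coeff i := by
  rw [← LaurentPolynomial.invert_apply, h]

/-- The nonsymmetric weight, whose symmetrization is the weight of the Macdonald polynomials with
parameter `k + 1`. Unlike the latter, it is a product over a full geometric progression, see
`exists_halfWeight_eq_mul_prod`. -/
def halfWeight (q : R) (k : ℕ) : R[T;T⁻¹] :=
  (1 - T 2) * ∏ l ∈ range k,
    ((1 - C ((q ^ 2) ^ (l + 1)) * T 2) * (1 - C ((q ^ 2) ^ (l + 1)) * T (-2)))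

theorem T_two_mul_T_neg_two : (T 2 * T (-2) : R[T;T⁻¹]) = 1 := by
  rw [← LaurentPolynomial.T_add, add_neg_cancel, LaurentPolynomial.T_zero]

theorem invert_halfWeight (q : R) (k : ℕ) : invert (halfWeight q k) =
    (1 - T (-2)) * ∏ l ∈ range k,
      ((1 - C ((q ^ 2) ^ (l + 1)) * T 2) * (1 - C ((q ^ 2) ^ (l + 1)) * T (-2))) := by
  simp only [halfWeight, map_mul, map_prod, map_sub, map_one, LaurentPolynomial.invert_T,
    LaurentPolynomial.invert_C, neg_neg, mul_comm]

theorem macdonaldWeight_eq_add (q : R) (k : ℕ) :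
    macdonaldWeight q (k + 1) = halfWeight q k + invert (halfWeight q k) := by
  rw [invert_halfWeight, halfWeight, macdonaldWeight, prod_range_succ']
  simp only [pow_mul, pow_zero, map_one, one_mul]
  linear_combination (∏ l ∈ range k, ((1 - C ((q ^ 2) ^ (l + 1)) * T 2) *
    (1 - C ((q ^ 2) ^ (l + 1)) * T (-2)) : R[T;T⁻¹])) * T_two_mul_T_neg_two (R := R)

theorem coeff_zero_mul_macdonaldWeight (q : R) (k : ℕ) {f : R[T;T⁻¹]} (hf : invert f = f) :
    (f * macdonaldWeight q (k + 1)).coeff 0 = 2 * (f * halfWeight q k).coeff 0 := by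
  have reflect : f * invert (halfWeight q k) = invert (f * halfWeight q k) := by rw [map_mul, hf]
  rw [macdonaldWeight_eq_add, mul_add, reflect, AddMonoidAlgebra.coeff_add, Finsupp.add_apply,
    LaurentPolynomial.invert_apply, neg_zero, two_mul]

/-- The polynomial in `T ^ 2` which is the half weight up to a monomial. -/
def weightPoly (Q : R) (k : ℕ) : Polynomial R :=
  ∏ l ∈ range (2 * k + 1), (1 - Polynomial.C (Q ^ ((l : ℤ) - k)) * Polynomial.X)

theorem natDegree_weightPoly_le (Q : R) (k : ℕ) : (weightPoly Q k).natDegree ≤ 2 * k + 1 := by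
  refine (Polynomial.natDegree_prod_le _ _).trans
    ((sum_le_card_nsmul _ _ 1 fun l _ => ?_).trans_eq (by simp))
  compute_degree

theorem coeff_weightPoly_ne_zero (hQ : Q ≠ 0) (k : ℕ) :
    (weightPoly Q k).coeff (2 * k + 1) ≠ 0 := by
  have leading := Polynomial.coeff_prod_of_natDegree_le (R := R) (s := range (2 * k + 1))
    (f := fun l => 1 - Polynomial.C (Q ^ ((l : ℤ) - k)) * Polynomial.X) (n := 1)
    (fun l _ => by compute_degree)
  rw [card_range, mul_one] at leading
  rw [weightPoly, leading, prod_ne_zero_iff]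
  intro l _
  simp [Polynomial.coeff_one, zpow_ne_zero _ hQ]

theorem eval_weightPoly_zpow (hQ : Q ≠ 0) {k s : ℕ} (hs : s ≤ 2 * k) :
    (weightPoly Q k).eval (Q ^ ((s : ℤ) - k)) = 0 := by
  rw [weightPoly, Polynomial.eval_prod]
  refine prod_eq_zero (i := 2 * k - s) (mem_range.2 (by lia)) ?_
  simp only [Polynomial.eval_sub, Polynomial.eval_one, Polynomial.eval_mul, Polynomial.eval_C,
    Polynomial.eval_X]
  rw [← zpow_add₀ hQ, show ((2 * k - s : ℕ) - k + ((s : ℤ) - k) : ℤ) = 0 by lia, zpow_zero,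
    sub_self]

theorem prod_range_two_mul_add_one {M : Type*} [CommMonoid M] (f : ℤ → M) (k : ℕ) :
    ∏ l ∈ range (2 * k + 1), f ((l : ℤ) - k) =
      f 0 * ∏ l ∈ range k, (f (l + 1) * f (-(l + 1))) := by
  induction k with
  | zero => simp
  | succ k ih =>
    rw [prod_range_succ _ k, ← mul_assoc, ← ih, show 2 * (k + 1) + 1 = 2 * k + 1 + 1 + 1 by ring,
      prod_range_succ, prod_range_succ', mul_assoc, mul_comm (f _) (f _)]
    push_cast
    congr 1
    · exact prod_congr rfl fun l _ => by congr 1; ring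
    · (congr 2; ring)

theorem exists_halfWeight_eq_mul_prod (hq : q ≠ 0) (k : ℕ) : ∃ c : R, c ≠ 0 ∧
    halfWeight q k = C c * T (-(2 * k)) *
      ∏ l ∈ range (2 * k + 1), (1 - C ((q ^ 2) ^ ((l : ℤ) - k)) * T 2) := by
  have hQ : q ^ 2 ≠ 0 := pow_ne_zero 2 hq
  refine ⟨∏ l ∈ range k, -(q ^ 2) ^ (l + 1),
    prod_ne_zero_iff.2 fun l _ => neg_ne_zero.2 (pow_ne_zero _ hQ), ?_⟩
  have reflect (l : ℕ) : (1 - C ((q ^ 2) ^ (l + 1)) * T (-2) : R[T;T⁻¹]) =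
      C (-(q ^ 2) ^ (l + 1)) * T (-2) * (1 - C ((q ^ 2) ^ (-(l + 1) : ℤ)) * T 2) := by
    have C_mul_C : (C ((q ^ 2) ^ (l + 1)) * C ((q ^ 2) ^ (-(l + 1) : ℤ)) : R[T;T⁻¹]) = 1 := by
      rw [← map_mul, ← zpow_natCast, ← zpow_add₀ hQ]
      simp
    rw [map_neg]
    linear_combination (-1 : R[T;T⁻¹]) * C_mul_C - (C ((q ^ 2) ^ (l + 1)) *
      C ((q ^ 2) ^ (-(l + 1) : ℤ))) * T_two_mul_T_neg_two (R := R)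
  have T_eq_prod : (T (-(2 * k)) : R[T;T⁻¹]) = ∏ l ∈ range k, T (-2) := by
    rw [prod_const, card_range, LaurentPolynomial.T_pow]; congr 1; ring
  rw [prod_range_two_mul_add_one fun j => (1 - C ((q ^ 2) ^ j) * T 2 : R[T;T⁻¹]), halfWeight,
    zpow_zero, map_one, one_mul, mul_left_comm, T_eq_prod, map_prod, ← prod_mul_distrib,
    ← prod_mul_distrib]
  congr 1
  refine prod_congr rfl fun l _ => ?_
  rw [reflect, ← zpow_natCast _ (l + 1)]
  push_cast
  ring

theorem coeff_mul_C_mul_T (f : R[T;T⁻¹]) (a : R) (n i : ℤ) :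
    (f * (C a * T n)).coeff i = f.coeff (i - n) * a := by
  rw [← LaurentPolynomial.single_eq_C_mul_T, AddMonoidAlgebra.coeff_mul_single_apply,
    sub_eq_add_neg]

theorem exists_coeff_mul_halfWeight (hq : q ≠ 0) (k : ℕ) : ∃ c : R, c ≠ 0 ∧
    ∀ (f : R[T;T⁻¹]) (i : ℤ), (f * halfWeight q k).coeff i = c *
      ∑ s ∈ range (2 * k + 2), (weightPoly (q ^ 2) k).coeff s * f.coeff (i + 2 * k - 2 * s) := by
  obtain ⟨c, hc, eq_mul_prod⟩ := exists_halfWeight_eq_mul_prod hq k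
  refine ⟨c, hc, fun f i => ?_⟩
  have eval_weightPoly : (weightPoly (q ^ 2) k).eval₂ C (T 2) =
      ∏ l ∈ range (2 * k + 1), (1 - C ((q ^ 2) ^ ((l : ℤ) - k)) * T 2) := by
    simp [weightPoly, Polynomial.eval₂_finsetProd]
  rw [eq_mul_prod, ← eval_weightPoly,
    Polynomial.eval₂_eq_sum_range' _ (Nat.lt_succ_of_le (natDegree_weightPoly_le _ k)), mul_sum,
    mul_sum, AddMonoidAlgebra.coeff_sum, Finset.sum_apply', mul_sum]
  refine sum_congr rfl fun s _ => ?_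
  rw [show (C c * T (-(2 * k)) * (C ((weightPoly (q ^ 2) k).coeff s) * T 2 ^ s) : R[T;T⁻¹]) =
      C (c * (weightPoly (q ^ 2) k).coeff s) * T (-(2 * k) + s * 2) by
    rw [map_mul, LaurentPolynomial.T_pow, LaurentPolynomial.T_add]; ring, coeff_mul_C_mul_T,
    show i - (-(2 * k) + s * 2) = i + 2 * k - 2 * s by ring]
  ring

/-- The Laurent polynomial in `Q ^ j` whose values at `0 ≤ j ≤ N` are the numerators of the
coefficients of the Rogers polynomial; its zeros at `-k ≤ j < 0` and at `N < j ≤ N + k` account for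
the vanishing of the other coefficients. -/
def rogersInterp (Q : R) (k N : ℕ) (j : ℤ) : R :=
  ∏ l ∈ range k, ((1 - Q ^ (j + l + 1)) * (1 - Q ^ (N - j + l + 1)))

theorem rogersInterp_natCast (Q : R) (k : ℕ) {N j : ℕ} (hj : j ≤ N) :
    rogersInterp Q k N j = rogersNum Q k j (N - j) := by
  refine prod_congr rfl fun l _ => ?_
  rw [← zpow_natCast, ← zpow_natCast]
  push_cast [hj]
  rfl

theorem rogersInterp_eq_zero (Q : R) (k N : ℕ) {j : ℤ} (hj : -(k : ℤ) ≤ j) (hj' : j ≤ N + k)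
    (outside : j < 0 ∨ N < j) : rogersInterp Q k N j = 0 := by
  rcases outside with h | h
  · refine prod_eq_zero (i := (-j - 1).toNat) (mem_range.2 (by lia)) ?_
    rw [show j + ((-j - 1).toNat : ℤ) + 1 = 0 by lia, zpow_zero, sub_self, zero_mul]
  · refine prod_eq_zero (i := (j - N - 1).toNat) (mem_range.2 (by lia)) ?_
    rw [show N - j + ((j - N - 1).toNat : ℤ) + 1 = 0 by lia, zpow_zero, sub_self, mul_zero]

theorem rogersInterp_add_one_ne_zero (hQ : ∀ j : ℕ, 0 < j → Q ^ j ≠ 1) (k N : ℕ) :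
    rogersInterp Q k N (N + k + 1) ≠ 0 := by
  refine prod_ne_zero_iff.2 fun l hl => ?_
  have hl := mem_range.1 hl
  refine mul_ne_zero (sub_ne_zero.2 fun h => ?_) (sub_ne_zero.2 fun h => ?_)
  · refine hQ (N + k + l + 2) (by lia) ?_
    rw [h, ← zpow_natCast]; congr 1; push_cast; ring
  · refine hQ (k - l) (by lia) ?_
    rw [← inv_inj, inv_one, h, ← zpow_natCast, ← zpow_neg]; congr 1; lia

theorem exists_rogersInterp_eq_sum (hQ : Q ≠ 0) (k N : ℕ) : ∃ p : Polynomial R, ∀ j : ℤ,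
    rogersInterp Q k N j = ∑ s ∈ range (2 * k + 1), p.coeff s * Q ^ (j * (s - k)) := by
  let p : Polynomial R := ∏ l ∈ range k, ((1 - Polynomial.C (Q ^ (l + 1)) * Polynomial.X) *
    (Polynomial.X - Polynomial.C (Q ^ (N + l + 1))))
  have natDegree_le : p.natDegree ≤ 2 * k := by
    refine (Polynomial.natDegree_prod_le _ _).trans
      ((sum_le_card_nsmul _ _ 2 fun l _ => ?_).trans (by simp [mul_comm]))
    compute_degree
  refine ⟨p, fun j => ?_⟩
  have eval_zpow : p.eval (Q ^ j) = rogersInterp Q k N j * Q ^ (j * k) := by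
    rw [Polynomial.eval_prod, rogersInterp, zpow_mul, zpow_natCast,
      show (Q ^ j) ^ k = ∏ _l ∈ range k, Q ^ j by rw [prod_const, card_range], ← prod_mul_distrib]
    refine prod_congr rfl fun l _ => ?_
    have zpow_add : Q ^ (j + l + 1) = Q ^ (l + 1) * Q ^ j := by
      rw [← zpow_natCast, ← zpow_add₀ hQ]; congr 1; push_cast; ring
    have zpow_sub : Q ^ ((N : ℤ) - j + l + 1) * Q ^ j = Q ^ (N + l + 1) := by
      rw [← zpow_natCast, ← zpow_add₀ hQ]; congr 1; push_cast; ring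
    simp only [Polynomial.eval_mul, Polynomial.eval_sub, Polynomial.eval_one, Polynomial.eval_C,
      Polynomial.eval_X]
    rw [zpow_add]
    linear_combination (1 - Q ^ (l + 1) * Q ^ j) * zpow_sub
  rw [Polynomial.eval_eq_sum_range' (Nat.lt_succ_of_le natDegree_le)] at eval_zpow
  rw [eq_div_of_mul_eq (zpow_ne_zero _ hQ) eval_zpow.symm, sum_div]
  refine sum_congr rfl fun s _ => ?_
  rw [mul_div_assoc, ← zpow_natCast, ← zpow_mul, ← zpow_sub₀ hQ, mul_sub]

theorem sum_weightPoly_mul_rogersInterp (hQ : Q ≠ 0) (k N : ℕ) (c : ℤ) :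
    ∑ i ∈ range (2 * k + 2), (weightPoly Q k).coeff i * rogersInterp Q k N (i + c) = 0 := by
  obtain ⟨p, hp⟩ := exists_rogersInterp_eq_sum hQ k N
  simp only [hp, mul_sum]
  rw [sum_comm]
  refine sum_eq_zero fun s hs => ?_
  have root := eval_weightPoly_zpow hQ (mem_range_succ_iff.1 hs)
  rw [Polynomial.eval_eq_sum_range' (Nat.lt_succ_of_le (natDegree_weightPoly_le Q k))] at root
  rw [← mul_zero (p.coeff s * Q ^ (c * (s - k))), ← root, mul_sum]
  refine sum_congr rfl fun i _ => ?_
  rw [← zpow_natCast, ← zpow_mul, add_mul, zpow_add₀ hQ, mul_comm ((s : ℤ) - k)]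
  ring

theorem coeff_rogers_eq_rogersInterp (q : R) (k N : ℕ) {j : ℤ} (hj : -(k : ℤ) ≤ j)
    (hj' : j ≤ N + k) : (rogers q k N).coeff (N - 2 * j) =
      rogersInterp (q ^ 2) k N j / rogersNum (q ^ 2) k 0 N := by
  by_cases outside : j < 0 ∨ N < j
  · rw [rogersInterp_eq_zero _ _ _ hj hj' outside, zero_div]
    exact coeff_rogers_eq_zero _ _ fun i hi => by lia
  · lift j to ℕ using by lia
    rw [coeff_rogers_sub _ _ (by lia), rogersInterp_natCast _ _ (by lia)]

theorem coeff_rogers_mul_halfWeight_eq_zero (hq : q ≠ 0) (k N : ℕ) {i : ℤ}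
    (hi : -(N : ℤ) < i) (hi' : i ≤ N) : (rogers q k N * halfWeight q k).coeff i = 0 := by
  obtain ⟨c, -, coeff_mul⟩ := exists_coeff_mul_halfWeight hq k
  rw [coeff_mul, mul_eq_zero_of_right]
  rcases Int.even_or_odd' (N - i) with ⟨h, parity | parity⟩
  · rw [← zero_div (rogersNum (q ^ 2) k 0 N),
      ← sum_weightPoly_mul_rogersInterp (pow_ne_zero 2 hq) k N (h - k), sum_div]
    refine sum_congr rfl fun s hs => ?_
    have hs := mem_range.1 hs
    rw [show i + 2 * k - 2 * s = N - 2 * (s + (h - k)) by lia,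
      coeff_rogers_eq_rogersInterp _ _ _ (by lia) (by lia), mul_div_assoc]
  · refine sum_eq_zero fun s _ => ?_
    rw [coeff_rogers_eq_zero _ _ fun j _ => by lia, mul_zero]

theorem coeff_rogers_mul_halfWeight_neg_ne_zero (hq : q ≠ 0)
    (hQ : ∀ j : ℕ, 0 < j → (q ^ 2) ^ j ≠ 1) (k N : ℕ) :
    (rogers q k N * halfWeight q k).coeff (-N) ≠ 0 := by
  have hQ0 : q ^ 2 ≠ 0 := pow_ne_zero 2 hq
  obtain ⟨c, hc, coeff_mul⟩ := exists_coeff_mul_halfWeight hq k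
  have relation := sum_weightPoly_mul_rogersInterp hQ0 k N (N - k)
  rw [sum_range_succ, show ((2 * k + 1 : ℕ) + (N - k) : ℤ) = N + k + 1 by lia] at relation
  rw [coeff_mul, sum_range_succ, coeff_rogers_eq_zero _ _ fun j _ => by lia, mul_zero, add_zero,
    sum_congr rfl fun s hs => by
      have hs := mem_range.1 hs
      rw [show -N + 2 * k - 2 * s = (N - 2 * (s + (N - k)) : ℤ) by lia,
        coeff_rogers_eq_rogersInterp _ _ _ (by lia) (by lia), ← mul_div_assoc],
    ← sum_div, eq_neg_of_add_eq_zero_left relation]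
  exact mul_ne_zero hc (div_ne_zero (neg_ne_zero.2 (mul_ne_zero (coeff_weightPoly_ne_zero hQ0 k)
    (rogersInterp_add_one_ne_zero hQ k N))) (rogersNum_zero_ne_zero hQ k N))

theorem coeff_zero_mul_rogers_mul_halfWeight (hq : q ≠ 0) (k N : ℕ) {f : R[T;T⁻¹]}
    (hf : ∀ i : ℤ, N < |i| → f.coeff i = 0) :
    (f * rogers q k N * halfWeight q k).coeff 0 =
      f.coeff N * (rogers q k N * halfWeight q k).coeff (-N) := by
  rw [mul_assoc, AddMonoidAlgebra.coeff_mul_apply_left, Finsupp.sum, sum_eq_single (N : ℤ),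
    add_zero]
  · intro i hi hiN
    have hi : |i| ≤ N := le_of_not_gt fun h => Finsupp.mem_support_iff.1 hi (hf i h)
    rw [abs_le] at hi
    rw [coeff_rogers_mul_halfWeight_eq_zero hq _ _ (by lia) (by lia), mul_zero]
  · intro hN
    rw [Finsupp.notMem_support_iff.1 hN, zero_mul]

theorem macdonaldForm_comm (q : R) (k : ℕ) (f g : R[T;T⁻¹]) :
    macdonaldForm q k f g = macdonaldForm q k g f := by
  rw [macdonaldForm, macdonaldForm, mul_comm f]

theorem macdonaldForm_sub_left (q : R) (k : ℕ) (f f' g : R[T;T⁻¹]) :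
    macdonaldForm q k (f - f') g = macdonaldForm q k f g - macdonaldForm q k f' g := by
  simp only [macdonaldForm, sub_mul, ← mul_sub, AddMonoidAlgebra.coeff_sub, Finsupp.sub_apply]

theorem macdonaldForm_C_mul_left (q : R) (k : ℕ) (a : R) (f g : R[T;T⁻¹]) :
    macdonaldForm q k (C a * f) g = a * macdonaldForm q k f g := by
  rw [macdonaldForm, macdonaldForm, mul_assoc, mul_assoc, ← LaurentPolynomial.smul_eq_C_mul,
    AddMonoidAlgebra.coeff_smul_apply, smul_eq_mul, mul_left_comm, mul_assoc f]

theorem macdonaldForm_rogers_right (hq : q ≠ 0) (k N : ℕ) {f : R[T;T⁻¹]} (even : invert f = f)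
    (hf : ∀ i : ℤ, N < |i| → f.coeff i = 0) : macdonaldForm q (k + 1) f (rogers q k N) =
      1 / 2 * (2 * (f.coeff N * (rogers q k N * halfWeight q k).coeff (-N))) := by
  rw [macdonaldForm, coeff_zero_mul_macdonaldWeight, coeff_zero_mul_rogers_mul_halfWeight hq k N hf]
  rw [map_mul, even, invert_rogers]

theorem macdonaldForm_rogers_eq_zero (hq : q ≠ 0) (k : ℕ) {m n : ℕ} (h : m ≠ n) :
    macdonaldForm q (k + 1) (rogers q k m) (rogers q k n) = 0 := by
  wlog hmn : m < n generalizing m n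
  · rw [macdonaldForm_comm]
    exact this h.symm (by lia)
  rw [macdonaldForm_rogers_right hq k n (invert_rogers q k m) fun i hi =>
      coeff_rogers_eq_zero_of_lt_abs q k (by lia),
    coeff_rogers_eq_zero_of_lt_abs q k (by rw [Nat.abs_cast]; lia), zero_mul, mul_zero, mul_zero]

theorem macdonaldForm_rogers_self_ne_zero [NeZero (2 : R)] (hq : q ≠ 0)
    (hQ : ∀ j : ℕ, 0 < j → (q ^ 2) ^ j ≠ 1) (k n : ℕ) :
    macdonaldForm q (k + 1) (rogers q k n) (rogers q k n) ≠ 0 := by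
  rw [macdonaldForm_rogers_right hq k n (invert_rogers q k n) fun i hi =>
    coeff_rogers_eq_zero_of_lt_abs q k hi, coeff_rogers_self hQ, one_mul, ← mul_assoc,
    one_div_mul_cancel two_ne_zero, one_mul]
  exact coeff_rogers_mul_halfWeight_neg_ne_zero hq hQ k n

theorem isMacdonaldFamily_rogers (hq : q ≠ 0) (hQ : ∀ j : ℕ, 0 < j → (q ^ 2) ^ j ≠ 1) (k : ℕ) :
    IsMacdonaldFamily q (k + 1) (rogers q k) where
  even := invert_rogers q k
  zero := rogers_zero hQ k
  leading n hn i hi := by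
    rw [AddMonoidAlgebra.coeff_add, Finsupp.add_apply, LaurentPolynomial.T_apply,
      LaurentPolynomial.T_apply]
    rcases hi.lt_or_eq with hi | hi
    · rw [coeff_rogers_eq_zero_of_lt_abs q k hi]
      rw [lt_abs] at hi
      rw [if_neg (by lia), if_neg (by lia), add_zero]
    · rcases eq_or_eq_neg_of_abs_eq hi.symm with rfl | rfl
      · rw [coeff_rogers_self hQ, if_pos rfl, if_neg (by lia), add_zero]
      · rw [coeff_neg_of_invert (invert_rogers q k n), coeff_rogers_self hQ, if_neg (by lia),
          if_pos rfl, zero_add]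
  orthogonal _ _ h := macdonaldForm_rogers_eq_zero hq k h

end Rogers

section MacdonaldFamily

open LaurentPolynomial (C T invert)

variable {R : Type*} [Field R] {q : R} {k : ℕ} {P P' : ℕ → R[T;T⁻¹]}

theorem IsMacdonaldFamily.coeff_eq_zero (hP : IsMacdonaldFamily q k P) {n : ℕ} {i : ℤ}
    (hi : n < |i|) : (P n).coeff i = 0 := by
  have hi' := lt_abs.1 hi
  rcases n.eq_zero_or_pos with rfl | hn
  · rw [hP.zero, ← LaurentPolynomial.T_zero, LaurentPolynomial.T_apply, if_neg (by lia)]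
  · rw [hP.leading n hn i hi.le, AddMonoidAlgebra.coeff_add, Finsupp.add_apply,
      LaurentPolynomial.T_apply, LaurentPolynomial.T_apply, if_neg (by lia), if_neg (by lia),
      add_zero]

theorem IsMacdonaldFamily.coeff_self (hP : IsMacdonaldFamily q k P) (n : ℕ) :
    (P n).coeff n = 1 := by
  rcases n.eq_zero_or_pos with rfl | hn
  · rw [hP.zero, ← LaurentPolynomial.T_zero, LaurentPolynomial.T_apply, if_pos Nat.cast_zero.symm]
  · rw [hP.leading n hn n (by simp), AddMonoidAlgebra.coeff_add, Finsupp.add_apply,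
      LaurentPolynomial.T_apply, LaurentPolynomial.T_apply, if_pos rfl, if_neg (by lia), add_zero]

theorem IsMacdonaldFamily.eq_zero_of_orthogonal (hP : IsMacdonaldFamily q k P)
    (nondegenerate : ∀ n, macdonaldForm q k (P n) (P n) ≠ 0) (n : ℕ) {f : R[T;T⁻¹]}
    (even : invert f = f) (degree_lt : ∀ i : ℤ, (n : ℤ) ≤ |i| → f.coeff i = 0)
    (orthogonal : ∀ m < n, macdonaldForm q k f (P m) = 0) : f = 0 := by
  induction n generalizing f with
  | zero => exact LaurentPolynomial.ext fun i => degree_lt i (by simp)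
  | succ n ih =>
    have eq_C_mul : f = C (f.coeff n) * P n := by
      have coeff_sub (i : ℤ) : (f - C (f.coeff n) * P n).coeff i =
          f.coeff i - f.coeff n * (P n).coeff i := by
        rw [AddMonoidAlgebra.coeff_sub, Finsupp.sub_apply, ← LaurentPolynomial.smul_eq_C_mul,
          AddMonoidAlgebra.coeff_smul_apply, smul_eq_mul]
      refine sub_eq_zero.1 (ih ?_ (fun i hi => ?_) fun m hm => ?_)
      · rw [map_sub, map_mul, LaurentPolynomial.invert_C, even, hP.even]
      · rw [coeff_sub]
        rcases hi.lt_or_eq with hi | hi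
        · rw [degree_lt i (by lia), hP.coeff_eq_zero hi, mul_zero, sub_zero]
        · rcases eq_or_eq_neg_of_abs_eq hi.symm with rfl | rfl
          · rw [hP.coeff_self, mul_one, sub_self]
          · rw [coeff_neg_of_invert even, coeff_neg_of_invert (hP.even n), hP.coeff_self, mul_one,
              sub_self]
      · rw [macdonaldForm_sub_left, macdonaldForm_C_mul_left, orthogonal m (by lia),
          hP.orthogonal n m hm.ne', mul_zero, sub_zero]
    have coeff_mul_form := orthogonal n n.lt_succ_self
    rw [eq_C_mul, macdonaldForm_C_mul_left] at coeff_mul_form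
    rw [eq_C_mul, (mul_eq_zero.1 coeff_mul_form).resolve_right (nondegenerate n), map_zero,
      zero_mul]

theorem IsMacdonaldFamily.unique (hP : IsMacdonaldFamily q k P)
    (nondegenerate : ∀ n, macdonaldForm q k (P n) (P n) ≠ 0) (hP' : IsMacdonaldFamily q k P') :
    P' = P := by
  ext1 n
  induction n using Nat.strong_induction_on with
  | _ n ih =>
    rcases n.eq_zero_or_pos with rfl | hn
    · rw [hP.zero, hP'.zero]
    · refine sub_eq_zero.1 (hP.eq_zero_of_orthogonal nondegenerate n ?_ (fun i hi => ?_) ?_)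
      · rw [map_sub, hP.even, hP'.even]
      · rw [AddMonoidAlgebra.coeff_sub, Finsupp.sub_apply, hP.leading n hn i hi,
          hP'.leading n hn i hi, sub_self]
      · intro m hm
        rw [macdonaldForm_sub_left, hP.orthogonal n m hm.ne', ← ih m hm,
          hP'.orthogonal n m hm.ne', sub_zero]

end MacdonaldFamily

section Specialization

/-! ### Specialization of Macdonald polynomials -/

theorem ratFunc_X_sq_pow_ne_one {j : ℕ} (hj : 0 < j) : ((RatFunc.X : RatFunc ℂ) ^ 2) ^ j ≠ 1 := by
  intro h
  rw [← pow_mul, ← RatFunc.algebraMap_X, ← map_pow, ← map_one (algebraMap (Polynomial ℂ) _)] at h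
  have degree := congrArg Polynomial.natDegree (RatFunc.algebraMap_injective ℂ h)
  rw [Polynomial.natDegree_X_pow, Polynomial.natDegree_one] at degree
  lia

theorem macdonald_add_one (k : ℕ) : macdonald (k + 1) = rogers RatFunc.X k :=
  have rogers_family := isMacdonaldFamily_rogers RatFunc.X_ne_zero
    (fun _ => ratFunc_X_sq_pow_ne_one) k
  rogers_family.unique
    (macdonaldForm_rogers_self_ne_zero RatFunc.X_ne_zero (fun _ => ratFunc_X_sq_pow_ne_one) k)
    (Classical.epsilon_spec ⟨_, rogers_family⟩)

theorem eval_denom_div_ne_zero {F : Type*} [Field F] {p d : Polynomial F} {x : F}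
    (hd : d.eval x ≠ 0) :
    (algebraMap (Polynomial F) (RatFunc F) p / algebraMap _ _ d).denom.eval x ≠ 0 := by
  obtain ⟨e, he⟩ := RatFunc.denom_div_dvd p d
  rw [he, Polynomial.eval_mul] at hd
  exact left_ne_zero_of_mul hd

theorem eval_div {F : Type*} [Field F] {p d : Polynomial F} {x : F} (hd : d.eval x ≠ 0) :
    (algebraMap (Polynomial F) (RatFunc F) p / algebraMap _ _ d).eval (RingHom.id F) x =
      p.eval x / d.eval x := by
  have hd0 : d ≠ 0 := by rintro rfl; simp at hd
  have num_mul := congrArg (Polynomial.eval x) ((RatFunc.num_mul_eq_mul_denom_iff hd0).2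
    (rfl : algebraMap (Polynomial F) (RatFunc F) p / algebraMap _ _ d = _))
  rw [Polynomial.eval_mul, Polynomial.eval_mul] at num_mul
  rw [RatFunc.eval, Polynomial.eval₂_id, Polynomial.eval₂_id,
    div_eq_div_iff (eval_denom_div_ne_zero hd) hd, num_mul]

theorem coeff_macdonald_sub (k : ℕ) {N j : ℕ} (hj : j ≤ N) :
    (macdonald (k + 1) N).coeff ((N : ℤ) - 2 * j) =
      algebraMap (Polynomial ℂ) (RatFunc ℂ) (rogersNum (Polynomial.X ^ 2) k j (N - j)) /
        algebraMap (Polynomial ℂ) (RatFunc ℂ) (rogersNum (Polynomial.X ^ 2) k 0 N) := by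
  rw [macdonald_add_one, coeff_rogers_sub _ _ hj, map_rogersNum, map_rogersNum, map_pow,
    RatFunc.algebraMap_X]

theorem eval_qpow_rogersNum (η : ℂ) (k a b : ℕ) :
    (rogersNum (Polynomial.X ^ 2) k a b).eval (qpow η 1) = rogersNum (qpow η 2) k a b := by
  rw [← Polynomial.coe_evalRingHom, map_rogersNum, Polynomial.coe_evalRingHom, Polynomial.eval_pow,
    Polynomial.eval_X, ← qpow_nat_mul, mul_one, Nat.cast_ofNat]

variable {η : ℂ} {k N : ℕ}

theorem macdonaldRegular_of_ne_zero (h : rogersNum (qpow η 2) k 0 N ≠ 0) :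
    MacdonaldRegular η (k + 1) N := by
  intro i
  by_cases hi : ∃ j : ℕ, j ≤ N ∧ (N : ℤ) - 2 * j = i
  · obtain ⟨j, hj, rfl⟩ := hi
    rw [coeff_macdonald_sub k hj]
    exact eval_denom_div_ne_zero (by rwa [eval_qpow_rogersNum])
  · rw [macdonald_add_one, coeff_rogers_eq_zero _ _ fun j hj hji => hi ⟨j, hj, hji⟩]
    simp

theorem macdonaldValue_eq_sum (h : rogersNum (qpow η 2) k 0 N ≠ 0) (x : ℂ) :
    macdonaldValue η (k + 1) N x = ∑ j ∈ range (N + 1),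
      rogersNum (qpow η 2) k j (N - j) / rogersNum (qpow η 2) k 0 N *
        qpow η ((N - 2 * j) * x) := by
  rw [macdonaldValue, sum_subset (s₂ := (range (N + 1)).image fun j : ℕ => (N : ℤ) - 2 * j)]
  · rw [sum_image fun (a : ℕ) _ (b : ℕ) _ (hab : (N : ℤ) - 2 * a = N - 2 * b) => by lia]
    refine sum_congr rfl fun j hj => ?_
    rw [coeff_macdonald_sub k (mem_range_succ_iff.1 hj),
      eval_div (by rwa [eval_qpow_rogersNum]), eval_qpow_rogersNum, eval_qpow_rogersNum]
    push_cast
    rfl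
  · intro i hi
    by_contra hne
    refine Finsupp.mem_support_iff.1 hi ?_
    rw [macdonald_add_one]
    exact coeff_rogers_eq_zero _ _ fun j hj hji =>
      hne (mem_image.2 ⟨j, mem_range_succ_iff.2 hj, hji⟩)
  · intro i _ hi
    rw [Finsupp.notMem_support_iff.1 hi, RatFunc.eval_zero, zero_mul]

theorem prod_qpow_sub_qpow (η : ℂ) (k N : ℕ) :
    ∏ j ∈ Icc 1 k, (qpow η (-(N + k + 1 : ℕ) + 2 * j) - qpow η (N + k + 1 : ℕ)) =
      qpow η (-(k * N)) * ∏ l ∈ range k, (1 - qpow η 2 ^ (N + l + 1)) := by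
  have prod_qpow (x : ℂ) (k : ℕ) : ∏ l ∈ range k, qpow η (-x + 2 * (l + 1 : ℕ)) =
      qpow η (k * (-x + k + 1)) := by
    induction k with
    | zero => simp [qpow_zero]
    | succ k ih => rw [prod_range_succ, ih, ← qpow_add]; congr 1; push_cast; ring
  rw [prod_Icc_one_eq_prod_range, ← prod_range_reflect (fun l => 1 - qpow η 2 ^ (N + l + 1)),
    show (-(k * N) : ℂ) = k * (-(N + k + 1 : ℕ) + k + 1) by push_cast; ring, ← prod_qpow,
    ← prod_mul_distrib]
  refine prod_congr rfl fun l hl => ?_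
  have hl := mem_range.1 hl
  rw [mul_sub, mul_one, ← qpow_nat_mul, ← qpow_add,
    show N + (k - 1 - l) + 1 = N + k + 1 - (l + 1) by lia, Nat.cast_sub (by lia)]
  congr 2
  ring

theorem macdonaldValue_mul_prod_qpow_sub_qpow (h : rogersNum (qpow η 2) k 0 N ≠ 0) (x : ℂ) :
    macdonaldValue η (k + 1) N x *
        ∏ j ∈ Icc 1 k, (qpow η (-(N + k + 1 : ℕ) + 2 * j) - qpow η (N + k + 1 : ℕ)) =
      qpow η ((x - k) * N) / (∏ l ∈ range k, (1 - qpow η 2 ^ (l + 1))) *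
        ∑ j ∈ range (N + 1), rogersNum (qpow η 2) k j (N - j) * qpow η (-(2 * x)) ^ j := by
  rw [macdonaldValue_eq_sum h, prod_qpow_sub_qpow, sum_mul, mul_sum]
  refine sum_congr rfl fun j _ => ?_
  have exponent : qpow η ((N - 2 * j) * x) * qpow η (-(k * N)) =
      qpow η ((x - k) * N) * qpow η (-(2 * x)) ^ j := by
    rw [← qpow_nat_mul, ← qpow_add, ← qpow_add]
    congr 1; ring
  rw [rogersNum_zero_left] at h ⊢
  rw [div_mul_eq_mul_div, div_mul_eq_mul_div, div_mul_eq_mul_div,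
    div_eq_div_iff h (left_ne_zero_of_mul h)]
  linear_combination rogersNum (qpow η 2) k j (N - j) *
    (∏ l ∈ range k, (1 - qpow η 2 ^ (l + 1))) * (∏ l ∈ range k, (1 - qpow η 2 ^ (N + l + 1))) *
      exponent

end Specialization

section Difference

/-! ### The antisymmetrized trace function -/

theorem tracePoly_neg (η : ℂ) (k n : ℕ) : tracePoly η k (-n - 1) =
    (tracePoly η k (n - 1)).comp (Polynomial.C (qpow η (2 * n)) * Polynomial.X) := by
  rw [tracePoly, tracePoly, Polynomial.prod_comp]
  refine prod_congr rfl fun l _ => ?_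
  have left_exponent : qpow η (-(2 * (-n - 1 - l))) = qpow η (2 * n) * qpow η (2 * (l + 1)) := by
    rw [← qpow_add]; congr 1; ring
  have right_exponent : qpow η (-(2 * (n - 1 - l))) * qpow η (2 * n) = qpow η (2 * (l + 1)) := by
    rw [← qpow_add]; congr 1; ring
  have inverse : qpow η (-2) ^ (l + 1) * qpow η (2 * (l + 1)) = 1 := by
    rw [← qpow_nat_mul, ← qpow_add]
    refine Eq.trans ?_ (qpow_zero η)
    congr 1; push_cast; ring
  have C_right_exponent := congrArg Polynomial.C right_exponent
  have C_inverse := congrArg Polynomial.C inverse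
  simp only [Polynomial.C_mul, Polynomial.C_1] at C_right_exponent C_inverse
  simp only [Polynomial.mul_comp, Polynomial.sub_comp, Polynomial.X_comp, Polynomial.C_comp,
    Polynomial.one_comp, left_exponent, Polynomial.C_mul]
  linear_combination (Polynomial.C (qpow η (2 * n)) - 1) * Polynomial.X * C_inverse +
    (Polynomial.C (qpow η (2 * n)) * Polynomial.X ^ 2 -
      Polynomial.C (qpow η (-2) ^ (l + 1)) * Polynomial.X) * C_right_exponent

variable {η ν : ℂ} {k : ℕ}

theorem explicitTrace_sub_explicitTrace_eq_sum_range (hν : ν ∈ regularDomain η k) (n : ℕ) :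
    explicitTrace η k (n - 1) ν - explicitTrace η k (-n - 1) ν =
      qpow η ((ν + k) * (n - 1 - k)) / (∏ l ∈ range k, (1 - qpow η (-2) ^ (l + 1))) *
        ∑ m ∈ range n, ∑ s ∈ range (2 * k + 1),
          (tracePoly η k (n - 1)).coeff s * qpow η (2 * (s - k - ν)) ^ m := by
  have prefactor : qpow η ((ν + k) * (-n - 1 - k)) =
      qpow η ((ν + k) * (n - 1 - k)) * qpow η (-(2 * n * (ν + k))) := by
    rw [← qpow_add]; congr 1; ring
  have telescope (s : ℕ) (hs : s ∈ range (2 * k + 1)) :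
      (tracePoly η k (n - 1)).coeff s * (1 - qpow η (2 * (s - k - ν)))⁻¹ -
        qpow η (-(2 * n * (ν + k))) * ((tracePoly η k (-n - 1)).coeff s *
          (1 - qpow η (2 * (s - k - ν)))⁻¹) =
      ∑ m ∈ range n, (tracePoly η k (n - 1)).coeff s * qpow η (2 * (s - k - ν)) ^ m := by
    have exponent : qpow η (-(2 * n * (ν + k))) * qpow η (2 * n) ^ s =
        qpow η (2 * (s - k - ν)) ^ n := by
      rw [← qpow_nat_mul, ← qpow_nat_mul, ← qpow_add]; congr 1; ring
    rw [tracePoly_neg, Polynomial.comp_C_mul_X_coeff, ← mul_sum,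
      (eq_inv_mul_iff_mul_eq₀ (one_sub_qpow_ne_zero hν hs)).2 (mul_neg_geom_sum _ n), ← exponent]
    ring
  rw [explicitTrace, explicitTrace, prefactor, sum_comm, ← sum_congr rfl telescope,
    sum_sub_distrib, ← mul_sum]
  ring

theorem prod_one_sub_eq_rogersNum (η : ℂ) (k : ℕ) {N m : ℕ} (hm : m ≤ N) :
    ∏ l ∈ range k, ((1 - qpow η (-2) ^ (l + 1 + m)) *
        (1 - qpow η (-(2 * ((N + k + 1 : ℕ) - 1))) * qpow η (-2) ^ (-(l + m) : ℤ))) =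
      rogersNum (qpow η (-2)) k m (N - m) := by
  rw [rogersNum, prod_mul_distrib, prod_mul_distrib,
    ← prod_range_reflect (fun l => 1 - qpow η (-2) ^ (N - m + l + 1))]
  congr 1
  · exact prod_congr rfl fun l _ => by rw [add_comm m, add_right_comm]
  · refine prod_congr rfl fun l hl => ?_
    have hl := mem_range.1 hl
    rw [← qpow_int_mul, ← qpow_nat_mul, ← qpow_add,
      show N - m + (k - 1 - l) + 1 = N + k - (l + m) by lia, Nat.cast_sub (by lia)]
    congr 2
    push_cast
    ring

theorem prod_one_sub_eq_zero_of_lt (η : ℂ) {k N m : ℕ} (hm : N < m) (hm' : m ≤ N + k) :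
    ∏ l ∈ range k, ((1 - qpow η (-2) ^ (l + 1 + m)) *
      (1 - qpow η (-(2 * ((N + k + 1 : ℕ) - 1))) * qpow η (-2) ^ (-(l + m) : ℤ))) = 0 := by
  refine prod_eq_zero (i := N + k - m) (mem_range.2 (by lia)) ?_
  rw [← qpow_int_mul, ← qpow_add, Nat.cast_sub hm',
    show -(2 * (((N + k + 1 : ℕ) : ℂ) - 1)) + (-(((N + k : ℕ) - m : ℤ) + m) : ℤ) * -2 = 0 by
      push_cast; ring, qpow_zero, sub_self, mul_zero]

theorem explicitTrace_sub_explicitTrace (hν : ν ∈ regularDomain η k) (N : ℕ) :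
    explicitTrace η k ((N + k + 1 : ℕ) - 1) ν - explicitTrace η k (-(N + k + 1 : ℕ) - 1) ν =
      qpow η ((ν + k) * N) / (∏ l ∈ range k, (1 - qpow η (-2) ^ (l + 1))) *
        ∑ j ∈ range (N + 1), rogersNum (qpow η (-2)) k j (N - j) * qpow η (-(2 * ν)) ^ j := by
  rw [explicitTrace_sub_explicitTrace_eq_sum_range hν,
    show ((N + k + 1 : ℕ) - 1 - k : ℂ) = N by push_cast; ring]
  simp only [sum_tracePoly_coeff_mul_qpow_pow]
  congr 1
  refine (sum_subset (range_mono (by lia)) fun m hm hmN => ?_).symm.trans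
    (sum_congr rfl fun m hm => ?_)
  · rw [prod_one_sub_eq_zero_of_lt η (by simpa [Nat.lt_succ_iff] using hmN)
      (mem_range_succ_iff.1 hm), zero_mul]
  · rw [prod_one_sub_eq_rogersNum η k (mem_range_succ_iff.1 hm)]

theorem neg_mem_regularDomain_neg (hν : ν ∈ regularDomain η k) : -ν ∈ regularDomain (-η) k := by
  intro l hl
  rw [qpow_neg_left]
  convert hν (-l) (by rwa [abs_neg]) using 2
  push_cast; ring

theorem rogersNum_qpow_two_ne_zero {N : ℕ} (hk : ∀ j : ℕ, 1 ≤ j → j ≤ k → qpow η (2 * j) ≠ 1)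
    (hN : ∀ j : ℕ, N + 1 ≤ j → j ≤ N + k → qpow η (2 * j) ≠ 1) :
    rogersNum (qpow η 2) k 0 N ≠ 0 := by
  have one_sub_ne_zero {j : ℕ} (h : qpow η (2 * j) ≠ 1) : 1 - qpow η 2 ^ j ≠ 0 := by
    rw [← qpow_nat_mul, mul_comm]
    exact sub_ne_zero.2 h.symm
  refine prod_ne_zero_iff.2 fun l hl => ?_
  have hl := mem_range.1 hl
  exact mul_ne_zero (one_sub_ne_zero (hk _ (by lia) (by lia)))
    (one_sub_ne_zero (hN _ (by lia) (by lia)))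

theorem qpow_two_mul_ne_one {κ : ℕ} (hη : η = Real.pi * Complex.I / κ) {j : ℤ} (h0 : 0 < j)
    (hj : j < κ) : qpow η (2 * j) ≠ 1 := by
  intro h
  obtain ⟨n, hn⟩ := Complex.exp_eq_one_iff.1 h
  have hκ : (κ : ℂ) ≠ 0 := Nat.cast_ne_zero.2 (by lia)
  have hπ : (Real.pi : ℂ) ≠ 0 := Complex.ofReal_ne_zero.2 Real.pi_ne_zero
  rw [hη] at hn
  field_simp at hn
  exact hj.not_ge (Int.le_of_dvd h0 ⟨n, mod_cast hn⟩)

theorem intCast_mem_regularDomain {κ : ℕ} (hη : η = Real.pi * Complex.I / κ) {j : ℤ} (hkj : k < j)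
    (hj : j + k < κ) : (j : ℂ) ∈ regularDomain η k := by
  intro l hl
  rw [abs_le] at hl
  exact mod_cast qpow_two_mul_ne_one hη (j := j - l) (by lia) (by lia)

end Difference

end QuantumTrace

end

open QuantumTrace in
theorem mainTheorem10_general {η x : ℂ} {k n : ℕ} (hη : η.re = 0) (hn : k + 1 ≤ n)
    (hk : ∀ j : ℕ, 1 ≤ j → j ≤ 2 * k → qpow η (2 * j) ≠ 1)
    (hnk : ∀ j : ℕ, n - k ≤ j → j < n → qpow η (2 * j) ≠ 1) (hx : x ∈ regularDomain η k) :
    MacdonaldRegular η (k + 1) (n - k - 1) ∧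
      renormalizedTrace (-η) k (-x) (n - 1) - renormalizedTrace (-η) k (-x) (-n - 1) =
        macdonaldValue η (k + 1) (n - k - 1) x *
          ∏ j ∈ Finset.Icc 1 k, (qpow η (-n + 2 * j) - qpow η n) := by
  obtain ⟨N, rfl⟩ : ∃ N, n = N + k + 1 := ⟨n - k - 1, by lia⟩
  rw [show N + k + 1 - k - 1 = N by lia]
  have denominator_ne_zero : rogersNum (qpow η 2) k 0 N ≠ 0 := rogersNum_qpow_two_ne_zero
    (fun j h1 h2 => hk j h1 (by lia)) fun j h1 h2 => hnk j (by lia) (by lia)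
  have hη' : (-η).re = 0 := by rw [Complex.neg_re, hη, neg_zero]
  have hk' (j : ℕ) (h1 : 1 ≤ j) (h2 : j ≤ 2 * k) : qpow (-η) (2 * j) ≠ 1 := by
    rw [qpow_neg_left]
    exact qpow_neg_ne_one (hk j h1 h2)
  have hx' := neg_mem_regularDomain_neg hx
  refine ⟨macdonaldRegular_of_ne_zero denominator_ne_zero, ?_⟩
  rw [renormalizedTrace_eq hη' hk' hx', renormalizedTrace_eq hη' hk' hx',
    explicitTrace_sub_explicitTrace hx', macdonaldValue_mul_prod_qpow_sub_qpow denominator_ne_zero]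
  simp only [qpow_neg_left, neg_neg, mul_neg]
  rw [show -((-x + k) * N) = (x - k) * N by ring]

theorem mainTheorem10 (κ k p n : ℕ) (m : ℤ) (hκ : 2 * k + 2 ≤ κ) (hn : k + 1 ≤ n) (hnκ : n ≤ κ)
    (hm : -(p : ℤ) + 2 * k + 1 ≤ m) (hmκ : m ≤ (κ : ℤ) - p - 1)
    (η : ℂ) (hη : η = Real.pi * Complex.I / κ) :
    QuantumTrace.MacdonaldRegular η (k + 1) (n - k - 1) ∧
      QuantumTrace.renormalizedTrace (-η) k (-m - p + k) (n - 1) -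
          QuantumTrace.renormalizedTrace (-η) k (-m - p + k) (-n - 1) =
        QuantumTrace.macdonaldValue η (k + 1) (n - k - 1) (m + p - k) *
          ∏ j ∈ Finset.Icc 1 k,
            (QuantumTrace.qpow η (-n + 2 * j) - QuantumTrace.qpow η n) := by
  rw [show (-m - p + k : ℂ) = -(m + p - k) by ring]
  exact mainTheorem10_general (by simp [hη]) hn
    (fun j _ _ => mod_cast QuantumTrace.qpow_two_mul_ne_one hη (j := j) (by lia) (by lia))
    (fun j _ _ => mod_cast QuantumTrace.qpow_two_mul_ne_one hη (j := j) (by lia) (by lia))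
    (mod_cast QuantumTrace.intCast_mem_regularDomain hη (j := m + p - k) (by lia) (by lia))
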